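/- Let $n \ge 3$, let $(L,h)$ be a closed connected smooth Riemannian manifold of dimension $n-1$, and let $C(L) = (0,\infty)\times L$ carry the Riemannian cone metric $g_{C(L)} = dr^2 + r^2 h$. Let $\overline{C(L)} = C(L)\cup\{o\}$ be its completion by the apex $o$, with the distance of $g_{C(L)}$ extended continuously to $\overline{C(L)}$; for $p\in\overline{C(L)}$ and $0<r\le\infty$ put $B_r(p)=\{x\in C(L) : \mathrm{dist}_{g_{C(L)}}(p,x)<r\}$ (so $o\notin B_r(p)$, and $B_\infty(p)=C(L)$). Let $g$ be a smooth Riemannian metric on $C(L)$ that is uniformly equivalent to $g_{C(L)}$, i.e. $\frac1{C'}\,g_{C(L)}\le g\le C' g_{C(L)}$ for some constant $C'>0$. Then there is a constant $C$ such that for all $p\in\overline{C(L)}$, all $0<r\le\infty$ and all real-valued $u\in C_0^\infty(B_r(p))$ (smooth functions whose support is a compact subset of $B_r(p)\subset C(L)$) the Sobolev inequality $$\left(\int_{B_r(p)} |u|^{\frac{2n}{n-2}}\,d\mathrm{vol}_g\right)^{\frac{n-2}{n}} \le C\int_{B_r(p)} |\nabla_g u|_g^2\,d\mathrm{vol}_g$$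 holds, and there is a constant $C$ such that for all such $p$, $r$, $u$ the Nash inequality $$\left(\int_{B_r(p)} u^2\,d\mathrm{vol}_g\right)^{1+\frac2n} \le C\left(\int_{B_r(p)} |\nabla_g u|_g^2\,d\mathrm{vol}_g\right)\left(\int_{B_r(p)} |u|\,d\mathrm{vol}_g\right)^{\frac4n}$$ holds. -/

import Mathlib

open scoped Manifold ContDiff ENNReal NNReal Topology
open MeasureTheory Bundle Set Filter

noncomputable section

section RiemannianManifold

variable {E H : Type*} [NormedAddCommGroup E] [NormedSpace ℝ E] [TopologicalSpace H]
  {I : ModelWithCorners ℝ E H}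
  {M : Type*} [TopologicalSpace M] [ChartedSpace H M] [IsManifold I ∞ M]

/-- Smooth Riemannian metrics on the manifold `M`. -/
abbrev SmoothMetric {E H : Type*} [NormedAddCommGroup E] [NormedSpace ℝ E] [TopologicalSpace H]
    (I : ModelWithCorners ℝ E H) (M : Type*) [TopologicalSpace M] [ChartedSpace H M]
    [IsManifold I ∞ M] :=
  ContMDiffRiemannianMetric I ∞ E (fun x : M => TangentSpace I x)

/-- Uniform equivalence of metrics: `C⁻¹ g' ≤ g ≤ C g'` as quadratic forms, for some constant
`C > 0`. -/
def UniformlyEquivalent (g g' : SmoothMetric I M) : Prop :=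
  ∃ C : ℝ, 0 < C ∧ ∀ (x : M) (v : TangentSpace I x),
    C⁻¹ * g'.inner x v v ≤ g.inner x v v ∧ g.inner x v v ≤ C * g'.inner x v v

/-- The Riemannian distance of `g`: the infimum of the `g`-lengths of `C¹` paths. -/
def riemannianDistance (g : SmoothMetric I M) (x y : M) : ℝ≥0∞ :=
  letI : RiemannianBundle (fun x : M => TangentSpace I x) := ⟨g.toRiemannianMetric⟩
  Manifold.riemannianEDist I x y

/-- The scalar product `g` on the tangent space at `x`, as a bilinear form. -/
def metricForm (g : SmoothMetric I M) (x : M) : LinearMap.BilinForm ℝ (TangentSpace I x) :=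
  LinearMap.mk₂ ℝ (fun v w => g.inner x v w)
    (fun v v' w => by rw [map_add, add_apply]) (fun c v w => by rw [map_smul, smul_apply])
    (fun v w w' => map_add _ _ _) (fun c v w => map_smul _ _ _)

theorem metricForm_nondegenerate (g : SmoothMetric I M) (x : M) :
    (metricForm g x).Nondegenerate := by
  have key : ∀ v : TangentSpace I x, g.inner x v v = 0 → v = 0 := fun v hv => by
    by_contra h
    exact (g.pos x v h).ne' hv
  exact ⟨fun v hv => key v (hv v), fun v hv => key v (hv v)⟩

section Gradient

variable [FiniteDimensional ℝ E]

instance finiteDimensional_tangentSpace (x : M) : FiniteDimensional ℝ (TangentSpace I x) :=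
  inferInstanceAs (FiniteDimensional ℝ E)

/-- The gradient `∇_g u`: the vector field with `g(∇_g u, w) = du(w)` for all `w`. -/
def riemannianGradient (g : SmoothMetric I M) (u : M → ℝ) (x : M) : TangentSpace I x :=
  ((metricForm g x).toDual (metricForm_nondegenerate g x)).symm
    (mfderiv I 𝓘(ℝ, ℝ) u x : TangentSpace I x →L[ℝ] ℝ).toLinearMap

/-- `|∇_g u|_g²`. -/
def gradientNormSq (g : SmoothMetric I M) (u : M → ℝ) (x : M) : ℝ :=
  g.inner x (riemannianGradient g u x) (riemannianGradient g u x)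

end Gradient

section Volume

variable {ι : Type*} [Fintype ι] [DecidableEq ι] [MeasurableSpace E] [BorelSpace E]
  [MeasurableSpace M]

/-- The function `√ det (g_ij)` in the coordinates of the preferred chart at `x₀`, where the
coordinates on `E` are those of the basis `b`. -/
def volumeDensity (b : Module.Basis ι ℝ E) (g : SmoothMetric I M) (x₀ : M) (y : E) : ℝ :=
  let φ := extChartAt I x₀
  √ (Matrix.det (Matrix.of fun i j : ι => g.inner (φ.symm y)
    (mfderiv 𝓘(ℝ, E) I φ.symm y (b i)) (mfderiv 𝓘(ℝ, E) I φ.symm y (b j))))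

/-- The measure `√ det (g_ij) dy` on the domain of the preferred chart at `x₀`, as a measure on `M`
(zero outside this domain). Here `b.addHaar` is Lebesgue measure `dy` in the coordinates of `b`. -/
def chartVolume (b : Module.Basis ι ℝ E) (g : SmoothMetric I M) (x₀ : M) : Measure M :=
  ((b.addHaar.restrict (extChartAt I x₀).target).withDensity
    (fun y => ENNReal.ofReal (volumeDensity b g x₀ y))).map (extChartAt I x₀).symm

/-- The Riemannian volume measure `dvol_g` of a (second countable, boundaryless) manifold. The
measures `chartVolume b g x₀` agree on overlaps of charts by the change of variables formula; their
supremum in the lattice of measures is the measure on `M` that restricts to each of them. It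
does not depend on the basis `b`. -/
def riemannianVolume (b : Module.Basis ι ℝ E) (g : SmoothMetric I M) : Measure M :=
  ⨆ x₀ : M, chartVolume b g x₀

end Volume

/-- `u ∈ C₀^∞(U)`: smooth, with compact support contained in the open set `U` (and extended by zero
to `M`). -/
def IsTestFunction (I : ModelWithCorners ℝ E H) (U : Set M) (u : M → ℝ) : Prop :=
  ContMDiff I 𝓘(ℝ, ℝ) ∞ u ∧ HasCompactSupport u ∧ tsupport u ⊆ U

/-- A field of bilinear forms is smooth as soon as its values on smooth vector fields are. -/
theorem contMDiff_bilin_of_apply [FiniteDimensional ℝ E]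
    (B : ∀ x : M, TangentSpace I x →L[ℝ] TangentSpace I x →L[ℝ] ℝ)
    (hB : ∀ (x₀ : M) (v w : ∀ x : M, TangentSpace I x),
      ContMDiffAt I I.tangent ∞ (fun x => (⟨x, v x⟩ : TangentBundle I M)) x₀ →
      ContMDiffAt I I.tangent ∞ (fun x => (⟨x, w x⟩ : TangentBundle I M)) x₀ →
      ContMDiffAt I 𝓘(ℝ, ℝ) ∞ (fun x => B x (v x) (w x)) x₀) :
    ContMDiff I (I.prod 𝓘(ℝ, E →L[ℝ] E →L[ℝ] ℝ)) ∞
      (fun x : M => TotalSpace.mk' (E →L[ℝ] E →L[ℝ] ℝ) 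
        (E := fun x : M => TangentSpace I x →L[ℝ] TangentSpace I x →L[ℝ] ℝ) x (B x)) := by
  intro x₀
  rw [contMDiffAt_section]
  let e := trivializationAt E (TangentSpace I : M → Type _) x₀
  have hsec : ∀ a : E, ContMDiffAt I I.tangent ∞
      (fun x => (⟨x, e.symmL ℝ x a⟩ : TangentBundle I M)) x₀ := by
    intro a
    rw [contMDiffAt_section]
    refine (contMDiffAt_const (c := a)).congr_of_eventuallyEq ?_
    filter_upwards [e.open_baseSet.mem_nhds (FiberBundle.mem_baseSet_trivializationAt' x₀)] with x hx
    change (e ⟨x, e.symmL ℝ x a⟩).2 = a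
    rw [e.symmL_apply hx, e.apply_mk_symm hx]
  let b := Module.finBasis ℝ E
  let φ : Fin (Module.finrank ℝ E) → E →L[ℝ] ℝ := fun i => LinearMap.toContinuousLinearMap (b.coord i)
  have key : ∀ Q : E →L[ℝ] E →L[ℝ] ℝ, Q = ∑ i, ∑ j, Q (b i) (b j) • (φ i).smulRight (φ j) := by
    intro Q
    ext v w
    have : Q v w = Q (∑ i, b.coord i v • b i) (∑ j, b.coord j w • b j) := by
      simp [b.sum_repr]
    rw [this]
    simp only [map_sum, map_smul, _root_.sum_apply, _root_.smul_apply,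
      ContinuousLinearMap.smulRight_apply, smul_eq_mul, φ, LinearMap.coe_toContinuousLinearMap']
    simp only [Finset.mul_sum]
    rw [Finset.sum_comm]
    refine Finset.sum_congr rfl fun i _ => ?_
    refine Finset.sum_congr rfl fun j _ => ?_
    ring
  have hcoord : ContMDiffAt I 𝓘(ℝ, E →L[ℝ] E →L[ℝ] ℝ) ∞ (fun x => ∑ i, ∑ j,
      (B x (e.symmL ℝ x (b i)) (e.symmL ℝ x (b j))) • (φ i).smulRight (φ j)) x₀ := by
    refine ContMDiffAt.sum fun i _ => ContMDiffAt.sum fun j _ => ?_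
    exact (hB x₀ _ _ (hsec _) (hsec _)).smul contMDiffAt_const
  refine hcoord.congr_of_eventuallyEq ?_
  filter_upwards [e.open_baseSet.mem_nhds (FiberBundle.mem_baseSet_trivializationAt' x₀)] with x hx
  rw [hom_trivializationAt_apply]
  refine (key _).trans (Finset.sum_congr rfl fun i _ => Finset.sum_congr rfl fun j _ => ?_)
  congr 1
  simp [ContinuousLinearMap.inCoordinates, e]
  rw [Trivialization.linearMapAt_apply, if_pos ?_, hom_trivializationAt_apply]
  · simp [ContinuousLinearMap.inCoordinates]
  · rw [hom_trivializationAt_baseSet]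
    exact ⟨hx, by simp⟩

end RiemannianManifold

/-- The open half-line `(0, ∞)`, as an open submanifold of `ℝ`. -/
def posReals : TopologicalSpace.Opens ℝ := ⟨Ioi 0, isOpen_Ioi⟩

/-- The underlying manifold `(0, ∞) × L` of the cone over `L`. -/
abbrev Cone (L : Type*) : Type _ := posReals × L

/-- The cone over a `k`-dimensional manifold is modelled on `ℝ × ℝᵏ`. -/
abbrev coneModel (k : ℕ) :
    ModelWithCorners ℝ (ℝ × EuclideanSpace ℝ (Fin k)) (ModelProd ℝ (EuclideanSpace ℝ (Fin k))) :=
  (𝓘(ℝ, ℝ)).prod (𝓡 k)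

/-- The standard basis of `ℝ × ℝᵏ`. -/
def coneBasis (k : ℕ) : Module.Basis (Unit ⊕ Fin k) ℝ (ℝ × EuclideanSpace ℝ (Fin k)) :=
  (Module.Basis.singleton Unit ℝ).prod (EuclideanSpace.basisFun (Fin k) ℝ).toBasis

namespace Cone

section Coordinates

variable {L : Type*}

/-- The radial coordinate `r`. -/
def radius (p : Cone L) : ℝ := (p.1 : ℝ)

variable [TopologicalSpace L]

/-- The differential of the radial coordinate. -/
def dr (k : ℕ) [ChartedSpace (EuclideanSpace ℝ (Fin k)) L] (p : Cone L) :
    TangentSpace (coneModel k) p →L[ℝ] ℝ :=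
  mfderiv (coneModel k) 𝓘(ℝ, ℝ) (radius : Cone L → ℝ) p

/-- The differential of the projection to the link. -/
def dlink (k : ℕ) [ChartedSpace (EuclideanSpace ℝ (Fin k)) L] (p : Cone L) :
    TangentSpace (coneModel k) p →L[ℝ] TangentSpace (𝓡 k) p.2 :=
  mfderiv (coneModel k) (𝓡 k) (Prod.snd : Cone L → L) p

variable {k : ℕ} [ChartedSpace (EuclideanSpace ℝ (Fin k)) L]

theorem contMDiff_radius : ContMDiff (coneModel k) 𝓘(ℝ, ℝ) ∞ (radius : Cone L → ℝ) :=
  contMDiff_subtype_val.comp contMDiff_fst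

theorem mfderiv_coe (t : posReals) :
    mfderiv 𝓘(ℝ, ℝ) 𝓘(ℝ, ℝ) (Subtype.val : posReals → ℝ) t = ContinuousLinearMap.id ℝ ℝ := by
  have h : MDifferentiableAt 𝓘(ℝ, ℝ) 𝓘(ℝ, ℝ) (Subtype.val : posReals → ℝ) t :=
    (contMDiff_subtype_val (n := 1)).mdifferentiableAt one_ne_zero
  rw [h.mfderiv]
  have : writtenInExtChartAt 𝓘(ℝ, ℝ) 𝓘(ℝ, ℝ) t (Subtype.val : posReals → ℝ) =ᶠ[𝓝 (t : ℝ)] id := by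
    filter_upwards [isOpen_Ioi.mem_nhds t.2] with x hx
    have hx' : x ∈ (extChartAt 𝓘(ℝ, ℝ) t).target := by
      simp [extChartAt, TopologicalSpace.Opens.chartAt_eq, chartAt_self_eq]
      simp [OpenPartialHomeomorph.subtypeRestr]
      exact hx
    have := (extChartAt 𝓘(ℝ, ℝ) t).right_inv hx'
    simpa [writtenInExtChartAt, TopologicalSpace.Opens.chartAt_eq] using this
  have h2 : extChartAt 𝓘(ℝ, ℝ) t t = (t : ℝ) := by
    simp [extChartAt, TopologicalSpace.Opens.chartAt_eq, chartAt_self_eq]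
  rw [h2, modelWithCornersSelf_coe, range_id, fderivWithin_univ, this.fderiv_eq, fderiv_id]

theorem dr_apply (p : Cone L) (v : TangentSpace (coneModel k) p) : dr k p v = v.1 := by
  have h : MDifferentiableAt 𝓘(ℝ, ℝ) 𝓘(ℝ, ℝ) (Subtype.val : posReals → ℝ) p.1 :=
    (contMDiff_subtype_val (n := 1)).mdifferentiableAt one_ne_zero
  have h2 : MDifferentiableAt (coneModel k) 𝓘(ℝ, ℝ) (Prod.fst : Cone L → posReals) p :=
    mdifferentiableAt_fst
  have := mfderiv_comp p h h2
  unfold dr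
  change mfderiv (coneModel k) 𝓘(ℝ, ℝ) (Subtype.val ∘ Prod.fst) p v = _
  rw [this, mfderiv_coe, mfderiv_fst]
  rfl

theorem dlink_apply (p : Cone L) (v : TangentSpace (coneModel k) p) : dlink k p v = v.2 := by
  unfold dlink
  rw [mfderiv_snd]
  rfl

theorem eq_zero_of_dr_dlink (p : Cone L) (v : TangentSpace (coneModel k) p)
    (h1 : dr k p v = 0) (h2 : dlink k p v = 0) : v = 0 := by
  rw [dr_apply] at h1
  rw [dlink_apply] at h2
  exact Prod.ext h1 h2

end Coordinates

section Metric

variable {k : ℕ} {L : Type*} [TopologicalSpace L] [ChartedSpace (EuclideanSpace ℝ (Fin k)) L]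
  [IsManifold (𝓡 k) ∞ L]

/-- The bilinear form `dr² + r² h` on the tangent spaces of the cone; see `metricInner_apply`. -/
def metricInner (h : SmoothMetric (𝓡 k) L) (p : Cone L) :
    TangentSpace (coneModel k) p →L[ℝ] TangentSpace (coneModel k) p →L[ℝ] ℝ :=
  (dr k p).smulRight (dr k p)
    + radius p ^ 2 • (ContinuousLinearMap.precomp ℝ (dlink k p) ∘L h.inner p.2 ∘L dlink k p)

theorem metricInner_apply (h : SmoothMetric (𝓡 k) L) (p : Cone L)
    (v w : TangentSpace (coneModel k) p) : metricInner h p v w =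
      dr k p v * dr k p w + radius p ^ 2 * h.inner p.2 (dlink k p v) (dlink k p w) := rfl

theorem contMDiff_metricInner (h : SmoothMetric (𝓡 k) L) :
    ContMDiff (coneModel k) ((coneModel k).prod 𝓘(ℝ, (ℝ × EuclideanSpace ℝ (Fin k)) →L[ℝ]
      (ℝ × EuclideanSpace ℝ (Fin k)) →L[ℝ] ℝ)) ∞
      (fun p : Cone L => TotalSpace.mk' ((ℝ × EuclideanSpace ℝ (Fin k)) →L[ℝ]
        (ℝ × EuclideanSpace ℝ (Fin k)) →L[ℝ] ℝ) (E := fun x : Cone L =>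
          TangentSpace (coneModel k) x →L[ℝ] TangentSpace (coneModel k) x →L[ℝ] ℝ)
        p (metricInner h p)) := by
  have hdr : ∀ (x₀ : Cone L) (v : ∀ x : Cone L, TangentSpace (coneModel k) x),
      ContMDiffAt (coneModel k) (coneModel k).tangent ∞
        (fun x => (⟨x, v x⟩ : TangentBundle (coneModel k) (Cone L))) x₀ →
      ContMDiffAt (coneModel k) 𝓘(ℝ, ℝ) ∞ (fun x => dr k x (v x)) x₀ := by
    intro x₀ v hv
    have h1 := (contMDiff_radius (k := k) (L := L)).contMDiff_tangentMap (m := ∞) le_rfl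
    have h2 := (contMDiff_snd_tangentBundle_modelSpace (n := ∞) ℝ 𝓘(ℝ, ℝ)).comp h1
    exact h2.contMDiffAt.comp x₀ hv
  have hdl : ∀ (x₀ : Cone L) (v : ∀ x : Cone L, TangentSpace (coneModel k) x),
      ContMDiffAt (coneModel k) (coneModel k).tangent ∞
        (fun x => (⟨x, v x⟩ : TangentBundle (coneModel k) (Cone L))) x₀ →
      ContMDiffAt (coneModel k) (𝓡 k).tangent ∞
        (fun x => (⟨x.2, dlink k x (v x)⟩ : TangentBundle (𝓡 k) L)) x₀ := by
    intro x₀ v hv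
    have h0 : ContMDiff (coneModel k) (𝓡 k) ∞ (Prod.snd : Cone L → L) := contMDiff_snd
    have h1 := h0.contMDiff_tangentMap (m := ∞) le_rfl
    exact h1.contMDiffAt.comp x₀ hv
  refine contMDiff_bilin_of_apply (metricInner h) fun x₀ v w hv hw => ?_
  refine ContMDiffAt.add (f := fun x => dr k x (v x) * dr k x (w x))
    (g := fun x => radius x ^ 2 * h.inner x.2 (dlink k x (v x)) (dlink k x (w x)))
    ((hdr x₀ v hv).mul (hdr x₀ w hw)) (ContMDiffAt.mul ?_ ?_)
  · exact (contMDiff_radius.contMDiffAt.pow 2)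
  · have hh : ContMDiffAt (coneModel k) ((𝓡 k).prod 𝓘(ℝ, EuclideanSpace ℝ (Fin k) →L[ℝ]
        EuclideanSpace ℝ (Fin k) →L[ℝ] ℝ)) ∞
        (fun p : Cone L => TotalSpace.mk' (EuclideanSpace ℝ (Fin k) →L[ℝ]
          EuclideanSpace ℝ (Fin k) →L[ℝ] ℝ) (E := fun x : L =>
          TangentSpace (𝓡 k) x →L[ℝ] TangentSpace (𝓡 k) x →L[ℝ] ℝ) p.2 (h.inner p.2)) x₀ :=
      (h.contMDiff.comp contMDiff_snd).contMDiffAt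
    have := ContMDiffAt.clm_bundle_apply₂ (F₁ := EuclideanSpace ℝ (Fin k))
      (F₂ := EuclideanSpace ℝ (Fin k)) (F₃ := ℝ) (E₃ := Bundle.Trivial L ℝ) hh (hdl x₀ v hv) (hdl x₀ w hw)
    simp only [contMDiffAt_totalSpace] at this
    exact this.2

theorem inner_self_nonneg (h : SmoothMetric (𝓡 k) L) (x : L) (w : TangentSpace (𝓡 k) x) :
    0 ≤ h.inner x w w := by
  by_cases hw : w = 0
  · rw [hw, map_zero]
  · exact (h.pos x w hw).le

theorem metricInner_pos (h : SmoothMetric (𝓡 k) L) (p : Cone L)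
    (v : TangentSpace (coneModel k) p) (hv : v ≠ 0) : 0 < metricInner h p v v := by
  rw [metricInner_apply]
  have hr : 0 < radius p := p.1.2
  by_cases h2 : dlink k p v = 0
  · have h1 : dr k p v ≠ 0 := fun h1 => hv (eq_zero_of_dr_dlink p v h1 h2)
    have h3 := mul_self_pos.2 h1
    rw [h2, map_zero, mul_zero, add_zero]
    exact h3
  · have := h.pos p.2 _ h2
    have := mul_self_nonneg (dr k p v)
    positivity

theorem metricInner_isVonNBounded (h : SmoothMetric (𝓡 k) L) (p : Cone L) :
    Bornology.IsVonNBounded ℝ {v : TangentSpace (coneModel k) p | metricInner h p v v < 1} := by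
  have hr : 0 < radius p := p.1.2
  obtain ⟨R, hR⟩ := (NormedSpace.isVonNBounded_iff' ℝ (E := EuclideanSpace ℝ (Fin k))).1
    (h.isVonNBounded p.2)
  have key : ∀ v : TangentSpace (coneModel k) p, metricInner h p v v < 1 →
      |dr k p v| ≤ 1 ∧ h.inner p.2 (radius p • dlink k p v) (radius p • dlink k p v) < 1 := by
    intro v hv
    rw [metricInner_apply] at hv
    have hpos := inner_self_nonneg h p.2 (dlink k p v)
    constructor
    · rw [abs_le]
      constructor <;> nlinarith [mul_nonneg (sq_nonneg (radius p)) hpos]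
    · rw [map_smul, map_smul, smul_apply, smul_eq_mul, smul_eq_mul]
      nlinarith [mul_self_nonneg (dr k p v)]
  have key' : ∀ v : TangentSpace (coneModel k) p, metricInner h p v v < 1 →
      |v.1| ≤ 1 ∧ h.inner p.2 (radius p • v.2) (radius p • v.2) < 1 := by
    intro v hv
    have := key v hv
    rwa [dr_apply, dlink_apply] at this
  refine (NormedSpace.isVonNBounded_iff' ℝ (E := ℝ × EuclideanSpace ℝ (Fin k))).2
    ⟨max 1 ((radius p)⁻¹ * R), fun v hv => ?_⟩
  obtain ⟨h1, h2⟩ := key' v hv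
  have h4 : ‖radius p • v.2‖ ≤ R := hR _ h2
  rw [norm_smul, Real.norm_eq_abs, abs_of_pos hr] at h4
  rw [Prod.norm_def]
  refine max_le_max h1 ?_
  rw [inv_mul_eq_div, le_div_iff₀ hr]
  linarith

end Metric

end Cone

section ConeGeometry

variable {k : ℕ} {L : Type*} [TopologicalSpace L] [ChartedSpace (EuclideanSpace ℝ (Fin k)) L]
  [IsManifold (𝓡 k) ∞ L]

/-- The cone metric `dr² + r² h` on `(0, ∞) × L`. -/
def coneMetric (h : SmoothMetric (𝓡 k) L) : SmoothMetric (coneModel k) (Cone L) where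
  inner := Cone.metricInner h
  symm p v w := by
    rw [Cone.metricInner_apply, Cone.metricInner_apply, h.symm, mul_comm (Cone.dr k p v)]
  pos := Cone.metricInner_pos h
  isVonNBounded := Cone.metricInner_isVonNBounded h
  contMDiff := Cone.contMDiff_metricInner h

/-- The completed cone `(0, ∞) × L ∪ {o}`, where `none` is the apex `o`. -/
abbrev ConeClosure (L : Type*) : Type _ := Option (Cone L)

/-- The neighbourhood filter of the apex, restricted to the cone. -/
def nhdsApex (L : Type*) : Filter (Cone L) := comap Cone.radius (𝓝 0)

/-- The distance of the cone metric from a point of the completed cone to a point of the cone. The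
distance to the apex `o` is the extension by continuity, `lim_{q → o} dist(q, x)`. -/
def coneDistance (h : SmoothMetric (𝓡 k) L) : ConeClosure L → Cone L → ℝ≥0∞
  | some p, x => riemannianDistance (coneMetric h) p x
  | none, x => liminf (fun q : Cone L => riemannianDistance (coneMetric h) q x) (nhdsApex L)

/-- The ball `B_r(p)` of the cone metric, as a subset of the cone (so it never contains the apex).
The centre may be the apex, and the radius may be `∞`. -/
def coneBall (h : SmoothMetric (𝓡 k) L) (p : ConeClosure L) (r : ℝ≥0∞) : Set (Cone L) :=
  {x | coneDistance h p x < r}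

/-- The Riemannian volume measure on the cone over a `k`-dimensional manifold. -/
def coneVolume [MeasurableSpace L] (g : SmoothMetric (coneModel k) (Cone L)) : Measure (Cone L) :=
  riemannianVolume (coneBasis k) g

end ConeGeometry

end

/-!
The support of `u` lies in the ball, so the ball plays no role: the integral of `|∇_g u|_g²` over
the ball is the integral over the whole cone (`lintegral_gradientNormSq_le_of_tsupport_subset`), and
it suffices to prove the Sobolev inequality on the cone (`exists_cone_sobolev`). The Nash inequality
then follows from Hölder's inequality (`lintegral_sq_rpow_le_of_holder`).

A chart of the link `L` gives coordinates `(r, y) ∈ (0, ∞) × ℝᵏ`, `k = n - 1`, on the part of the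
cone over its domain. In a small ball around a point of `L` the metric `g`, being uniformly
equivalent to `dr² + r² h`, is comparable with `dr² + r² |dy|²`, uniformly in `r`
(`exists_chartForm_cone_bounds`). Hence its volume density is comparable with `r ^ k`, and
`|∇_g u|_g²` bounds `(∂_r u)² + r⁻² |∂_y u|²` (`coneEnergy`). So only an inequality in Euclidean
coordinates with the weight `r ^ k` is needed, and `L` is covered by finitely many such balls.

The map `(r, y) ↦ (r, r y)` has Jacobian `r ^ k` and distorts `dr² + r² |dy|²` by a bounded factor
as long as `y` is bounded. It turns the Gagliardo-Nirenberg-Sobolev inequality on `ℝ × ℝᵏ` into the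
inequality wanted, for functions supported over a ball (`lintegral_sobolev_cone_coordinates`). A
cutoff `χ(y)` localizes to a ball; its derivative contributes `u² / r²`, which is controlled by
Hardy's inequality along the rays (`lintegral_hardy_cone`). This is where `n ≥ 3` enters a second
time.

The Riemannian volume is a supremum over all charts. That it is bounded above, on the domain of one
chart, by the measure of that chart is the change of variables formula
(`riemannianVolume_restrict_source_le`).
-/

/-! ### Hardy's inequality and cone coordinates -/

/-- A version of `lintegral_mono_set` that only looks at the set where the integrand does not
vanish. -/
theorem setLIntegral_le_of_eq_zero {α : Type*} [MeasurableSpace α] {μ : Measure α} {s t : Set α}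
    (hs : MeasurableSet s) (ht : MeasurableSet t) {f : α → ℝ≥0∞}
    (h : ∀ x ∈ s, x ∉ t → f x = 0) : ∫⁻ x in s, f x ∂μ ≤ ∫⁻ x in t, f x ∂μ := by
  rw [← lintegral_indicator hs, ← lintegral_indicator ht]
  refine lintegral_mono fun x => ?_
  by_cases hx : x ∈ s <;> by_cases hx' : x ∈ t <;> simp [hx, hx']
  exact h x hx hx'

/-- **Hardy's inequality** on the half-line with the weight `r ^ k`, `k ≥ 2`: it is the integral of
`0 ≤ ((m + 1) f + 2 r f')² r ^ m`, `m = k - 2`, in which the cross term is the derivative of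
`r ^ (m + 1) f²` up to lower order terms. -/
theorem lintegral_hardy {k : ℕ} (hk : 2 ≤ k) {f f' : ℝ → ℝ} {a b : ℝ} (ha : 0 < a)
    (hf : ∀ r, 0 < r → HasDerivAt f (f' r) r) (hf' : ContinuousOn f' (Ioi 0))
    (hsupp : ∀ r, 0 < r → r ∉ Icc a b → f r = 0) :
    ∫⁻ r in Ioi (0 : ℝ), ENNReal.ofReal (r ^ k) * ENNReal.ofReal ((r⁻¹ * f r) ^ 2) ≤
      4 * ∫⁻ r in Ioi (0 : ℝ), ENNReal.ofReal (r ^ k) * ENNReal.ofReal (f' r ^ 2) := by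
  obtain ⟨m, rfl⟩ : ∃ m, k = m + 2 := ⟨k - 2, by omega⟩
  set A := a / 2 with hA
  set B := max a b + 1 with hB
  have hA0 : 0 < A := by positivity
  have hAB : A ≤ B := by have := le_max_left a b; linarith
  have hfA : f A = 0 := hsupp A hA0 fun h => by have := h.1; linarith
  have hfB : f B = 0 := hsupp B (by linarith) fun h => by
    have := h.2; have := le_max_right a b; linarith
  have hpos : ∀ r ∈ Icc A B, 0 < r := fun r hr => hA0.trans_le hr.1
  have hfc : ContinuousOn f (Icc A B) := fun r hr =>
    (hf r (hpos r hr)).continuousAt.continuousWithinAt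
  have hfc' : ContinuousOn f' (Icc A B) := hf'.mono fun r hr => hpos r hr
  have hc1 : ContinuousOn (fun r => r ^ m * f r ^ 2) (Icc A B) := by fun_prop
  have hc2 : ContinuousOn (fun r => r ^ (m + 2) * f' r ^ 2) (Icc A B) := by fun_prop
  have hc3 : ContinuousOn (fun r => (m + 1) * r ^ m * f r ^ 2 + r ^ (m + 1) * (2 * f r * f' r))
      (Icc A B) := by fun_prop
  have hi1 := hc1.intervalIntegrable_of_Icc (μ := volume) hAB
  have hi2 := hc2.intervalIntegrable_of_Icc (μ := volume) hAB
  have hi3 := hc3.intervalIntegrable_of_Icc (μ := volume) hAB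
  -- the fundamental theorem of calculus for `r ^ (m + 1) f²`, which vanishes at both ends
  have h0 : ∫ r in A..B, ((m + 1) * r ^ m * f r ^ 2 + r ^ (m + 1) * (2 * f r * f' r)) = 0 := by
    rw [intervalIntegral.integral_eq_sub_of_hasDerivAt (f := fun r => r ^ (m + 1) * f r ^ 2) _ hi3]
    · simp [hfA, hfB]
    · intro r hr
      rw [uIcc_of_le hAB] at hr
      have h1 := (hasDerivAt_pow (m + 1) r).mul ((hf r (hpos r hr)).pow 2)
      refine h1.congr_deriv ?_
      simp only [Nat.add_sub_cancel, Pi.pow_apply]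
      push_cast
      ring
  have hmain : ∫ r in A..B, r ^ m * f r ^ 2 ≤ 4 * ∫ r in A..B, r ^ (m + 2) * f' r ^ 2 := by
    have hm : (0 : ℝ) < m + 1 := by positivity
    have : ∫ r in A..B, r ^ m * f r ^ 2 ≤ ∫ r in A..B, (4 * (r ^ (m + 2) * f' r ^ 2) +
        (2 / (m + 1)) * ((m + 1) * r ^ m * f r ^ 2 + r ^ (m + 1) * (2 * f r * f' r))) := by
      refine intervalIntegral.integral_mono_on hAB hi1
        ((hi2.const_mul _).add (hi3.const_mul _)) fun r hr => ?_
      have hr0 := hpos r hr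
      have h1 : 0 ≤ r ^ m * (f r + 2 * (r * f' r) / (m + 1)) ^ 2 := by positivity
      have h2 : r ^ m * (4 * (r * f' r) ^ 2 / (m + 1) ^ 2) ≤ r ^ m * (4 * (r * f' r) ^ 2) := by
        refine mul_le_mul_of_nonneg_left (div_le_self (by positivity) ?_) (by positivity)
        have : (0 : ℝ) ≤ m := by positivity
        nlinarith
      have h3 : r ^ m * (f r + 2 * (r * f' r) / (m + 1)) ^ 2 =
          r ^ m * (4 * (r * f' r) ^ 2 / (m + 1) ^ 2) - r ^ m * f r ^ 2 +
          (2 / (m + 1)) * ((m + 1) * r ^ m * f r ^ 2 + r ^ (m + 1) * (2 * f r * f' r)) := by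
        field_simp
        ring
      have h4 : r ^ m * (4 * (r * f' r) ^ 2) = 4 * (r ^ (m + 2) * f' r ^ 2) := by ring
      linarith
    rw [intervalIntegral.integral_add (hi2.const_mul _) (hi3.const_mul _),
      intervalIntegral.integral_const_mul, intervalIntegral.integral_const_mul, h0] at this
    linarith
  have key : ∀ F : ℝ → ℝ, ContinuousOn F (Icc A B) → (∀ r ∈ Icc A B, 0 ≤ F r) →
      ∫⁻ r in Ioc A B, ENNReal.ofReal (F r) = ENNReal.ofReal (∫ r in A..B, F r) := by
    intro F hF hF0
    rw [intervalIntegral.integral_of_le hAB, ofReal_integral_eq_lintegral_ofReal]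
    · exact (hF.integrableOn_Icc).mono_set Ioc_subset_Icc_self
    · exact (ae_restrict_iff' measurableSet_Ioc).2 (ae_of_all _ fun r hr =>
        hF0 r (Ioc_subset_Icc_self hr))
  calc ∫⁻ r in Ioi (0 : ℝ), ENNReal.ofReal (r ^ (m + 2)) * ENNReal.ofReal ((r⁻¹ * f r) ^ 2)
      ≤ ∫⁻ r in Ioc A B, ENNReal.ofReal (r ^ (m + 2)) * ENNReal.ofReal ((r⁻¹ * f r) ^ 2) := by
        refine setLIntegral_le_of_eq_zero measurableSet_Ioi measurableSet_Ioc fun r hr hr' => ?_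
        rw [hsupp r hr fun h => hr' ⟨by linarith [h.1], by linarith [h.2, le_max_right a b]⟩]
        simp
    _ = ∫⁻ r in Ioc A B, ENNReal.ofReal (r ^ m * f r ^ 2) := by
        refine setLIntegral_congr_fun measurableSet_Ioc fun r hr => ?_
        have hr0 : 0 < r := hA0.trans hr.1
        rw [← ENNReal.ofReal_mul (by positivity)]
        congr 1
        field_simp
        ring
    _ = ENNReal.ofReal (∫ r in A..B, r ^ m * f r ^ 2) :=
        key _ hc1 fun r hr => by have := hpos r hr; positivity
    _ ≤ ENNReal.ofReal (4 * ∫ r in A..B, r ^ (m + 2) * f' r ^ 2) := ENNReal.ofReal_le_ofReal hmain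
    _ = 4 * ∫⁻ r in Ioc A B, ENNReal.ofReal (r ^ (m + 2) * f' r ^ 2) := by
        rw [ENNReal.ofReal_mul (by norm_num), key _ hc2 fun r hr => by
          have := hpos r hr; positivity]
        norm_num
    _ ≤ 4 * ∫⁻ r in Ioi (0 : ℝ), ENNReal.ofReal (r ^ (m + 2)) * ENNReal.ofReal (f' r ^ 2) := by
        refine mul_le_mul' le_rfl ?_
        refine (setLIntegral_congr_fun measurableSet_Ioc fun r hr => ?_).trans_le
          (lintegral_mono_set fun r hr => hA0.trans hr.1)
        have hr0 : 0 < r := hA0.trans hr.1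
        exact ENNReal.ofReal_mul (by positivity)

section ConeCoordinates

variable {F : Type*} [NormedAddCommGroup F] [NormedSpace ℝ F] [FiniteDimensional ℝ F]
  [MeasurableSpace F] [BorelSpace F]

/-- Lebesgue measure in the coordinates `(r, x)` with `r > 0` becomes `r ^ dim F dr dy` in the
coordinates `(r, y)` with `x = r y`. -/
theorem lintegral_cone_coordinates (ν : Measure F) [ν.IsAddHaarMeasure] {G : ℝ × F → ℝ≥0∞}
    (hG : Measurable G) :
    ∫⁻ z in Ioi (0 : ℝ) ×ˢ univ, G z ∂(volume.prod ν) =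
      ∫⁻ z in Ioi (0 : ℝ) ×ˢ univ,
        ENNReal.ofReal (z.1 ^ Module.finrank ℝ F) * G (z.1, z.1 • z.2) ∂(volume.prod ν) := by
  have hr : (volume.prod ν).restrict (Ioi (0 : ℝ) ×ˢ univ) =
      (volume.restrict (Ioi (0 : ℝ))).prod ν := by
    rw [← Measure.prod_restrict, Measure.restrict_univ]
  rw [hr, lintegral_prod _ hG.aemeasurable, lintegral_prod _ (by fun_prop)]
  refine setLIntegral_congr_fun measurableSet_Ioi fun r (hr : 0 < r) => ?_
  simp only
  have h := Measure.map_addHaar_smul ν hr.ne'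
  have h2 : ∫⁻ y, G (r, r • y) ∂ν = ∫⁻ x, G (r, x) ∂(Measure.map (r • ·) ν) :=
    (lintegral_map (f := fun x => G (r, x)) (by fun_prop) (by fun_prop)).symm
  rw [lintegral_const_mul _ (by fun_prop), h2, h, lintegral_smul_measure, smul_eq_mul, ← mul_assoc,
    ← ENNReal.ofReal_mul (by positivity), abs_of_pos (by positivity),
    mul_inv_cancel₀ (by positivity), ENNReal.ofReal_one, one_mul]

/-- The energy density `(∂_r v)² + r⁻² |∂_y v|²` of a function of the coordinates `(r, y)` on a
cone. -/
noncomputable def coneEnergy (v : ℝ × F → ℝ) (z : ℝ × F) : ℝ :=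
  (fderiv ℝ v z (1, 0)) ^ 2 +
    (z.1⁻¹ * ‖(fderiv ℝ v z).comp (ContinuousLinearMap.inr ℝ ℝ F)‖) ^ 2

theorem measurable_coneEnergy (v : ℝ × F → ℝ) : Measurable (coneEnergy v) := by
  have h := measurable_fderiv ℝ v
  have h1 : Measurable fun z => fderiv ℝ v z (1, 0) :=
    (ContinuousLinearMap.apply ℝ ℝ ((1, 0) : ℝ × F)).measurable.comp h
  have hc : Continuous fun A : (ℝ × F) →L[ℝ] ℝ => A.comp (ContinuousLinearMap.inr ℝ ℝ F) := by
    fun_prop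
  have h2 : Measurable fun z => (fderiv ℝ v z).comp (ContinuousLinearMap.inr ℝ ℝ F) :=
    hc.measurable.comp h
  unfold coneEnergy
  fun_prop

end ConeCoordinates

/-! ### The Sobolev inequality in cone coordinates -/

section ConeSobolev

variable {F : Type*} [NormedAddCommGroup F] [NormedSpace ℝ F]

theorem coneEnergy_nonneg (v : ℝ × F → ℝ) (z : ℝ × F) : 0 ≤ coneEnergy v z := by
  unfold coneEnergy
  positivity

/-- If `f (r, y) = w (r, r y)`, then `|Dw|² ≤ C ((∂_r f)² + r⁻² |∂_y f|²)` as long as `y` is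
bounded. -/
theorem norm_fderiv_sq_le_coneEnergy {f w : ℝ × F → ℝ} {z : ℝ × F} (hz : 0 < z.1) {R : ℝ}
    (hR : ‖z.2‖ ≤ R) (hw : DifferentiableAt ℝ w (z.1, z.1 • z.2))
    (hfw : f =ᶠ[𝓝 z] fun z => w (z.1, z.1 • z.2)) :
    ‖fderiv ℝ w (z.1, z.1 • z.2)‖ ^ 2 ≤ 2 * (1 + R) ^ 2 * coneEnergy f z := by
  have hR0 : 0 ≤ R := (norm_nonneg _).trans hR
  have hΦ : HasFDerivAt (fun z : ℝ × F => (z.1, z.1 • z.2)) _ z :=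
    (hasFDerivAt_fst (𝕜 := ℝ)).prodMk ((hasFDerivAt_fst (𝕜 := ℝ)).smul (hasFDerivAt_snd (𝕜 := ℝ)))
  have hf : fderiv ℝ f z = _ := ((hw.hasFDerivAt.comp z hΦ).congr_of_eventuallyEq hfw).fderiv
  set A := fderiv ℝ w (z.1, z.1 • z.2) with hA
  set D := fderiv ℝ f z with hD
  have hDA : ∀ (a : ℝ) (η : F), D (a, η) = A (a, z.1 • η + a • z.2) := by
    intro a η
    rw [hf]
    simp
  set P := |D (1, 0)| with hP
  set Q := ‖D.comp (ContinuousLinearMap.inr ℝ ℝ F)‖ with hQ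
  have hbound : ‖A‖ ≤ (1 + R) * (P + z.1⁻¹ * Q) := by
    refine ContinuousLinearMap.opNorm_le_bound _ (by positivity) fun v => ?_
    obtain ⟨a, ξ⟩ := v
    -- the inverse of the differential of `(r, y) ↦ (r, r y)` is `(a, ξ) ↦ (a, r⁻¹ (ξ - a y))`
    have h1 : A (a, ξ) = a * D (1, 0) + D (0, z.1⁻¹ • (ξ - a • z.2)) := by
      have : D (a, z.1⁻¹ • (ξ - a • z.2)) = A (a, ξ) := by
        rw [hDA]
        congr 2
        rw [smul_inv_smul₀ hz.ne']
        simp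
      rw [← this, ← smul_eq_mul, ← map_smul, ← map_add]
      congr 1
      simp
    have ha : |a| ≤ ‖(a, ξ)‖ := norm_fst_le (a, ξ)
    have hξ : ‖ξ‖ ≤ ‖(a, ξ)‖ := norm_snd_le (a, ξ)
    set N := ‖(a, ξ)‖ with hN
    have hN0 : 0 ≤ N := norm_nonneg _
    have h2 : |D (0, z.1⁻¹ • (ξ - a • z.2))| ≤ Q * (z.1⁻¹ * ((1 + R) * N)) := by
      have h3 := (D.comp (ContinuousLinearMap.inr ℝ ℝ F)).le_opNorm (z.1⁻¹ • (ξ - a • z.2))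
      rw [ContinuousLinearMap.comp_apply, ContinuousLinearMap.inr_apply, Real.norm_eq_abs] at h3
      refine h3.trans ?_
      rw [norm_smul, norm_inv, Real.norm_of_nonneg hz.le]
      gcongr
      refine (norm_sub_le _ _).trans ?_
      rw [norm_smul, Real.norm_eq_abs]
      have : |a| * ‖z.2‖ ≤ N * R := by gcongr
      linarith
    rw [h1, Real.norm_eq_abs]
    refine (abs_add_le _ _).trans ?_
    rw [abs_mul]
    have h5 : |a| * P ≤ N * P := by gcongr
    have h6 : 0 ≤ R * (N * P) := by positivity
    calc |a| * P + |D (0, z.1⁻¹ • (ξ - a • z.2))| ≤ N * P + Q * (z.1⁻¹ * ((1 + R) * N)) := by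
          linarith
      _ ≤ N * P + R * (N * P) + Q * (z.1⁻¹ * ((1 + R) * N)) := by linarith
      _ = (1 + R) * (P + z.1⁻¹ * Q) * N := by ring
  have hE : coneEnergy f z = P ^ 2 + (z.1⁻¹ * Q) ^ 2 := by
    rw [coneEnergy, hP, sq_abs]
  have h7 : ‖A‖ ^ 2 ≤ ((1 + R) * (P + z.1⁻¹ * Q)) ^ 2 := by gcongr
  have h8 : (P + z.1⁻¹ * Q) ^ 2 ≤ 2 * (P ^ 2 + (z.1⁻¹ * Q) ^ 2) := by
    nlinarith [sq_nonneg (P - z.1⁻¹ * Q)]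
  calc ‖A‖ ^ 2 ≤ (1 + R) ^ 2 * (P + z.1⁻¹ * Q) ^ 2 := by rw [← mul_pow]; exact h7
    _ ≤ (1 + R) ^ 2 * (2 * (P ^ 2 + (z.1⁻¹ * Q) ^ 2)) := by gcongr
    _ = _ := by rw [hE]; ring

/-- The Gagliardo-Nirenberg-Sobolev inequality for `p = 2`, in terms of integrals. -/
theorem lintegral_sobolev_of_finrank {V : Type*} [NormedAddCommGroup V] [NormedSpace ℝ V]
    [FiniteDimensional ℝ V] [MeasurableSpace V] [BorelSpace V] (μ : Measure V)
    [μ.IsAddHaarMeasure] {n : ℕ} (hn : 3 ≤ n) (hV : Module.finrank ℝ V = n) :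
    ∃ C : ℝ≥0, ∀ w : V → ℝ, ContDiff ℝ 1 w → HasCompactSupport w →
      (∫⁻ z, ‖w z‖ₑ ^ (2 * (n : ℝ) / ((n : ℝ) - 2)) ∂μ) ^ (((n : ℝ) - 2) / (n : ℝ)) ≤
        C * ∫⁻ z, ‖fderiv ℝ w z‖ₑ ^ 2 ∂μ := by
  have hn' : (3 : ℝ) ≤ n := by exact_mod_cast hn
  refine ⟨eLpNormLESNormFDerivOfEqInnerConst μ 2 ^ 2, fun w hw hc => ?_⟩
  set p : ℝ≥0 := ⟨2 * (n : ℝ) / ((n : ℝ) - 2), by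
    have : (0 : ℝ) < n - 2 := by linarith
    positivity⟩ with hp
  have hpr : (p : ℝ) = 2 * (n : ℝ) / ((n : ℝ) - 2) := rfl
  have hn2 : (0 : ℝ) < n - 2 := by linarith
  have hp0 : (0 : ℝ) < p := by rw [hpr]; positivity
  have h := eLpNorm_le_eLpNorm_fderiv_of_eq_inner μ hw hc (p := 2) (p' := p) (by norm_num)
    (by omega) (by
      rw [hpr, hV]
      push_cast
      field_simp)
  rw [eLpNorm_eq_lintegral_rpow_enorm_toReal (by
        simpa using (NNReal.coe_pos.1 hp0).ne') (by simp),
    eLpNorm_eq_lintegral_rpow_enorm_toReal (by simp) (by simp)] at h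
  simp only [ENNReal.coe_toReal] at h
  have h2 := ENNReal.rpow_le_rpow h (z := 2) (by norm_num)
  rw [← ENNReal.rpow_mul, ENNReal.mul_rpow_of_nonneg _ _ (by norm_num), ← ENNReal.rpow_mul,
    hpr] at h2
  have e1 : 1 / (2 * (n : ℝ) / (n - 2)) * 2 = (n - 2) / n := by field_simp
  rw [e1] at h2
  norm_num at h2
  exact_mod_cast h2

end ConeSobolev

section ConeSobolev

variable {F : Type*} [NormedAddCommGroup F] [NormedSpace ℝ F]

/-- The energy density of `χ v`, for a function `χ` of `y` alone. -/
theorem coneEnergy_mul_le {v : ℝ × F → ℝ} {χ : F → ℝ} {z : ℝ × F} {M : ℝ}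
    (hv : DifferentiableAt ℝ v z) (hχ : DifferentiableAt ℝ χ z.2) (h1 : |χ z.2| ≤ 1)
    (hM : ‖fderiv ℝ χ z.2‖ ≤ M) :
    coneEnergy (fun z => χ z.2 * v z) z ≤
      2 * coneEnergy v z + 2 * M ^ 2 * (z.1⁻¹ * v z) ^ 2 := by
  have hχ' : HasFDerivAt (fun z : ℝ × F => χ z.2) _ z := hχ.hasFDerivAt.comp z hasFDerivAt_snd
  have h : fderiv ℝ (fun z : ℝ × F => χ z.2 * v z) z = _ := (hχ'.mul hv.hasFDerivAt).fderiv
  have e1 : fderiv ℝ (fun z : ℝ × F => χ z.2 * v z) z (1, 0) = χ z.2 * fderiv ℝ v z (1, 0) := by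
    rw [h]; simp
  have e2 : (fderiv ℝ (fun z : ℝ × F => χ z.2 * v z) z).comp (ContinuousLinearMap.inr ℝ ℝ F) =
      χ z.2 • (fderiv ℝ v z).comp (ContinuousLinearMap.inr ℝ ℝ F) + v z • fderiv ℝ χ z.2 := by
    rw [h]; ext; simp
  have hM0 : 0 ≤ M := (norm_nonneg _).trans hM
  set Q := ‖(fderiv ℝ v z).comp (ContinuousLinearMap.inr ℝ ℝ F)‖ with hQ
  have h2 : ‖(fderiv ℝ (fun z : ℝ × F => χ z.2 * v z) z).comp (ContinuousLinearMap.inr ℝ ℝ F)‖ ≤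
      Q + M * |v z| := by
    rw [e2]
    refine (norm_add_le _ _).trans ?_
    rw [norm_smul, norm_smul, Real.norm_eq_abs, Real.norm_eq_abs, mul_comm M]
    exact add_le_add (mul_le_of_le_one_left (norm_nonneg _) h1)
      (mul_le_mul_of_nonneg_left hM (abs_nonneg _))
  have h3 : (χ z.2) ^ 2 ≤ 1 := by rw [← sq_abs]; exact pow_le_one₀ (abs_nonneg _) h1
  have h4 : ‖(fderiv ℝ (fun z : ℝ × F => χ z.2 * v z) z).comp
      (ContinuousLinearMap.inr ℝ ℝ F)‖ ^ 2 ≤ (Q + M * |v z|) ^ 2 := by gcongr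
  have h5 : (Q + M * |v z|) ^ 2 ≤ 2 * Q ^ 2 + 2 * M ^ 2 * v z ^ 2 := by
    rw [← sq_abs (v z)]; nlinarith [sq_nonneg (Q - M * |v z|)]
  unfold coneEnergy
  rw [e1, mul_pow, mul_pow, mul_pow z.1⁻¹ Q, mul_pow z.1⁻¹ (v z)]
  have h6 : 0 ≤ (fderiv ℝ v z (1, 0)) ^ 2 := sq_nonneg _
  have h7 : 0 ≤ (z.1⁻¹) ^ 2 := sq_nonneg _
  nlinarith [mul_le_mul_of_nonneg_right h3 h6, mul_le_mul_of_nonneg_left (h4.trans h5) h7]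

variable [FiniteDimensional ℝ F] [MeasurableSpace F] [BorelSpace F]

/-- The Sobolev inequality for functions of the coordinates `(r, y)` on a cone that are supported
in `r ∈ [a, b]`, `‖y‖ ≤ R`: this is the inequality on `ℝ × F` for the function
`w (r, x) = f (r, x / r)`. -/
theorem lintegral_sobolev_cone_coordinates (ν : Measure F) [ν.IsAddHaarMeasure] {n : ℕ}
    (hn : 3 ≤ n) (hF : Module.finrank ℝ F + 1 = n) {R : ℝ} (hR : 0 ≤ R) :
    ∃ C : ℝ≥0, ∀ f : ℝ × F → ℝ, ContDiffOn ℝ 1 f (Ioi 0 ×ˢ univ) → ∀ a b : ℝ, 0 < a →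
      (∀ z : ℝ × F, 0 < z.1 → f z ≠ 0 → z.1 ∈ Icc a b ∧ ‖z.2‖ ≤ R) →
      (∫⁻ z in Ioi (0 : ℝ) ×ˢ univ, ENNReal.ofReal (z.1 ^ (n - 1)) *
        ‖f z‖ₑ ^ (2 * (n : ℝ) / ((n : ℝ) - 2)) ∂(volume.prod ν)) ^ (((n : ℝ) - 2) / (n : ℝ)) ≤
      C * ∫⁻ z in Ioi (0 : ℝ) ×ˢ univ, ENNReal.ofReal (z.1 ^ (n - 1)) *
        ENNReal.ofReal (coneEnergy f z) ∂(volume.prod ν) := by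
  have hk : Module.finrank ℝ F = n - 1 := by omega
  have hV : Module.finrank ℝ (ℝ × F) = n := by
    rw [Module.finrank_prod, Module.finrank_self]; omega
  obtain ⟨C, hC⟩ := lintegral_sobolev_of_finrank ((volume : Measure ℝ).prod ν) hn hV
  refine ⟨C * (2 * (1 + R) ^ 2).toNNReal, fun f hf a b ha hsupp => ?_⟩
  have hS : IsOpen (Ioi (0 : ℝ) ×ˢ (univ : Set F)) := isOpen_Ioi.prod isOpen_univ
  have hSm : MeasurableSet (Ioi (0 : ℝ) ×ˢ (univ : Set F)) := hS.measurableSet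
  set w : ℝ × F → ℝ := fun z => if 0 < z.1 then f (z.1, z.1⁻¹ • z.2) else 0 with hw
  have hw0 : ∀ z, w z ≠ 0 → 0 < z.1 ∧ z.1 ∈ Icc a b ∧ ‖z.1⁻¹ • z.2‖ ≤ R := by
    intro z h
    have hz0 : 0 < z.1 := by
      by_contra h'
      exact h (if_neg h')
    have h' : f (z.1, z.1⁻¹ • z.2) ≠ 0 := by simpa only [hw, hz0, if_true] using h
    exact ⟨hz0, hsupp (z.1, z.1⁻¹ • z.2) hz0 h'⟩
  have hd0 : ∀ z, w =ᶠ[𝓝 z] (fun _ => 0) → ‖fderiv ℝ w z‖ₑ ^ 2 = 0 := by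
    intro z h
    have : fderiv ℝ w z = 0 := by rw [h.fderiv_eq, fderiv_const_apply]
    rw [this, ← ofReal_norm, norm_zero, ENNReal.ofReal_zero, zero_pow two_ne_zero]
  have hw1 : ContDiff ℝ 1 w := by
    refine contDiff_iff_contDiffAt.2 fun z => ?_
    by_cases hz : 0 < z.1
    · have h1 : ContDiffAt ℝ 1 (fun z : ℝ × F => (z.1, z.1⁻¹ • z.2)) z :=
        contDiffAt_fst.prodMk ((contDiffAt_fst.inv hz.ne').smul contDiffAt_snd)
      have h2 : ContDiffAt ℝ 1 f (z.1, z.1⁻¹ • z.2) := hf.contDiffAt (hS.mem_nhds ⟨hz, trivial⟩)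
      refine (ContDiffAt.comp z h2 h1).congr_of_eventuallyEq ?_
      filter_upwards [(isOpen_Ioi.preimage continuous_fst).mem_nhds hz] with y hy
      exact if_pos hy
    · refine (contDiffAt_const (c := (0 : ℝ))).congr_of_eventuallyEq ?_
      have hz' : z.1 < a := by linarith
      filter_upwards [(isOpen_Iio.preimage continuous_fst).mem_nhds hz'] with y hy
      by_contra h
      exact absurd (hw0 y h).2.1.1 (not_le.2 hy)
  have hw2 : HasCompactSupport w := by
    refine HasCompactSupport.intro
      (K := Icc a b ×ˢ Metric.closedBall (0 : F) (b * R))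
      (isCompact_Icc.prod (isCompact_closedBall _ _)) fun z hz => ?_
    by_contra h
    obtain ⟨hz0, h1, h2⟩ := hw0 z h
    refine hz ⟨h1, ?_⟩
    rw [mem_closedBall_zero_iff]
    rw [norm_smul, norm_inv, Real.norm_of_nonneg hz0.le, inv_mul_le_iff₀ hz0] at h2
    exact h2.trans (mul_le_mul_of_nonneg_right h1.2 hR)
  have hfw : ∀ z : ℝ × F, 0 < z.1 → f z = w (z.1, z.1 • z.2) := by
    intro z hz
    simp only [hw, hz, if_true]
    rw [inv_smul_smul₀ hz.ne']
  have hL : ∫⁻ z in Ioi (0 : ℝ) ×ˢ univ, ENNReal.ofReal (z.1 ^ (n - 1)) *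
      ‖f z‖ₑ ^ (2 * (n : ℝ) / ((n : ℝ) - 2)) ∂(volume.prod ν) ≤
      ∫⁻ z, ‖w z‖ₑ ^ (2 * (n : ℝ) / ((n : ℝ) - 2)) ∂(volume.prod ν) := by
    have hm := hw1.continuous.measurable
    refine le_trans (le_of_eq ?_) (setLIntegral_le_lintegral (Ioi (0 : ℝ) ×ˢ univ) _)
    rw [lintegral_cone_coordinates ν (G := fun z => ‖w z‖ₑ ^ (2 * (n : ℝ) / ((n : ℝ) - 2)))
      (by fun_prop), hk]
    refine setLIntegral_congr_fun hSm fun z hz => ?_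
    rw [hfw z hz.1]
  have hRt : ∫⁻ z, ‖fderiv ℝ w z‖ₑ ^ 2 ∂(volume.prod ν) ≤ (2 * (1 + R) ^ 2).toNNReal *
      ∫⁻ z in Ioi (0 : ℝ) ×ˢ univ, ENNReal.ofReal (z.1 ^ (n - 1)) *
        ENNReal.ofReal (coneEnergy f z) ∂(volume.prod ν) := by
    have hm : Measurable (fderiv ℝ w) := measurable_fderiv ℝ w
    calc ∫⁻ z, ‖fderiv ℝ w z‖ₑ ^ 2 ∂(volume.prod ν)
        = ∫⁻ z in univ, ‖fderiv ℝ w z‖ₑ ^ 2 ∂(volume.prod ν) := by rw [Measure.restrict_univ]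
      _ ≤ ∫⁻ z in Ioi (0 : ℝ) ×ˢ univ, ‖fderiv ℝ w z‖ₑ ^ 2 ∂(volume.prod ν) := by
        refine setLIntegral_le_of_eq_zero .univ hSm fun z _ hz => ?_
        have hz' : z.1 < a := by
          by_contra h
          exact hz ⟨ha.trans_le (not_lt.1 h), trivial⟩
        have : w =ᶠ[𝓝 z] fun _ => 0 := by
          filter_upwards [(isOpen_Iio.preimage continuous_fst).mem_nhds hz'] with y hy
          by_contra h
          exact absurd (hw0 y h).2.1.1 (not_le.2 hy)
        exact hd0 z this
      _ = ∫⁻ z in Ioi (0 : ℝ) ×ˢ univ, ENNReal.ofReal (z.1 ^ (n - 1)) *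
          ‖fderiv ℝ w (z.1, z.1 • z.2)‖ₑ ^ 2 ∂(volume.prod ν) := by
        rw [lintegral_cone_coordinates ν (by fun_prop), hk]
      _ ≤ ∫⁻ z in Ioi (0 : ℝ) ×ˢ univ, (2 * (1 + R) ^ 2).toNNReal *
          (ENNReal.ofReal (z.1 ^ (n - 1)) * ENNReal.ofReal (coneEnergy f z))
            ∂(volume.prod ν) := by
        refine setLIntegral_mono' hSm fun z hz => ?_
        have hz0 : 0 < z.1 := hz.1
        rw [mul_left_comm]
        refine mul_le_mul' le_rfl ?_
        have hev : f =ᶠ[𝓝 z] fun z => w (z.1, z.1 • z.2) := by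
          filter_upwards [(isOpen_Ioi.preimage continuous_fst).mem_nhds hz0] with y hy
          exact hfw y hy
        -- beyond `‖y‖ = R` the bound on `Dw` is not available, but `w` vanishes there
        by_cases hzR : ‖z.2‖ ≤ R
        · have := norm_fderiv_sq_le_coneEnergy hz0 hzR
            ((hw1.differentiable one_ne_zero) _) hev
          change _ ≤ ENNReal.ofReal _ * _
          rw [← ENNReal.ofReal_mul (by positivity), ← ofReal_norm,
            ← ENNReal.ofReal_pow (norm_nonneg _)]
          exact ENNReal.ofReal_le_ofReal this
        · have hx : R < ‖z.1⁻¹ • (z.1 • z.2)‖ := by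
            rw [inv_smul_smul₀ hz0.ne']; exact not_le.1 hzR
          have hcont : ContinuousAt (fun y : ℝ × F => ‖y.1⁻¹ • y.2‖) (z.1, z.1 • z.2) :=
            ContinuousAt.norm (ContinuousAt.smul (ContinuousAt.inv₀ continuousAt_fst hz0.ne')
              continuousAt_snd)
          have : w =ᶠ[𝓝 (z.1, z.1 • z.2)] fun _ => 0 := by
            filter_upwards [hcont.eventually_const_lt hx] with y hy
            by_contra h
            exact absurd (hw0 y h).2.2 (not_le.2 hy)
          rw [hd0 _ this]
          exact zero_le
      _ = _ := lintegral_const_mul' _ _ ENNReal.coe_ne_top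
  calc _ ≤ (∫⁻ z, ‖w z‖ₑ ^ (2 * (n : ℝ) / ((n : ℝ) - 2)) ∂(volume.prod ν)) ^
        (((n : ℝ) - 2) / (n : ℝ)) := by
        have : (3 : ℝ) ≤ n := by exact_mod_cast hn
        exact ENNReal.rpow_le_rpow hL (div_nonneg (by linarith) (by linarith))
    _ ≤ _ := hC w hw1 hw2
    _ ≤ _ := by
        rw [ENNReal.coe_mul, mul_assoc]
        gcongr

end ConeSobolev

section ConeSobolev

variable {F : Type*} [NormedAddCommGroup F] [NormedSpace ℝ F]

theorem coneEnergy_eq_zero {f : ℝ × F → ℝ} {z : ℝ × F} (h : f =ᶠ[𝓝 z] fun _ => 0) :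
    coneEnergy f z = 0 := by
  have : fderiv ℝ f z = 0 := by rw [h.fderiv_eq, fderiv_const_apply]
  simp [coneEnergy, this]

variable [FiniteDimensional ℝ F] [MeasurableSpace F] [BorelSpace F]

/-- Hardy's inequality on the rays of a cone. -/
theorem lintegral_hardy_cone (ν : Measure F) [SFinite ν] {k : ℕ} (hk : 2 ≤ k) {U : Set F}
    (hU : IsOpen U) {v : ℝ × F → ℝ} (hv : ContDiffOn ℝ 1 v (Ioi 0 ×ˢ U)) {a b : ℝ} (ha : 0 < a)
    (hsupp : ∀ z ∈ Ioi (0 : ℝ) ×ˢ U, v z ≠ 0 → z.1 ∈ Icc a b) :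
    ∫⁻ z in Ioi (0 : ℝ) ×ˢ U, ENNReal.ofReal (z.1 ^ k) * ENNReal.ofReal ((z.1⁻¹ * v z) ^ 2)
        ∂(volume.prod ν) ≤
      4 * ∫⁻ z in Ioi (0 : ℝ) ×ˢ U, ENNReal.ofReal (z.1 ^ k) * ENNReal.ofReal (coneEnergy v z)
        ∂(volume.prod ν) := by
  have hS : IsOpen (Ioi (0 : ℝ) ×ˢ U) := isOpen_Ioi.prod hU
  have hfd : Measurable fun z => fderiv ℝ v z (1, 0) :=
    (ContinuousLinearMap.apply ℝ ℝ ((1, 0) : ℝ × F)).measurable.comp (measurable_fderiv ℝ v)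
  have hvm : AEMeasurable v ((volume.prod ν).restrict (Ioi (0 : ℝ) ×ˢ U)) :=
    hv.continuousOn.aemeasurable hS.measurableSet
  have hle : 4 * ∫⁻ z in Ioi (0 : ℝ) ×ˢ U, ENNReal.ofReal (z.1 ^ k) *
      ENNReal.ofReal ((fderiv ℝ v z (1, 0)) ^ 2) ∂(volume.prod ν) ≤
      4 * ∫⁻ z in Ioi (0 : ℝ) ×ˢ U, ENNReal.ofReal (z.1 ^ k) * ENNReal.ofReal (coneEnergy v z)
        ∂(volume.prod ν) := by
    gcongr with z
    exact le_add_of_nonneg_right (sq_nonneg _)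
  refine le_trans ?_ hle
  have hr : (volume.prod ν).restrict (Ioi (0 : ℝ) ×ˢ U) =
      (volume.restrict (Ioi (0 : ℝ))).prod (ν.restrict U) := (Measure.prod_restrict _ _).symm
  rw [hr] at hvm ⊢
  rw [lintegral_prod_symm _ (by fun_prop), lintegral_prod_symm _ (by fun_prop),
    ← lintegral_const_mul' _ _ (by norm_num)]
  refine setLIntegral_mono' hU.measurableSet fun y hy => ?_
  have hd : ∀ r : ℝ, 0 < r → ContDiffAt ℝ 1 v (r, y) := fun r hr =>
    hv.contDiffAt (hS.mem_nhds ⟨hr, hy⟩)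
  refine lintegral_hardy hk ha (f := fun r => v (r, y)) (f' := fun r => fderiv ℝ v (r, y) (1, 0))
    (b := b) (fun r hr => ?_) (fun r hr => ?_) (fun r hr hr' => ?_)
  · have h1 := ((hd r hr).differentiableAt one_ne_zero).hasFDerivAt
    have h2 : HasDerivAt (fun r : ℝ => (r, y)) (1, 0) r :=
      (hasDerivAt_id r).prodMk (hasDerivAt_const r y)
    exact h1.comp_hasDerivAt r h2
  · have h1 : ContinuousAt (fderiv ℝ v) (r, y) := (hd r hr).continuousAt_fderiv one_ne_zero
    have h2 : ContinuousAt (fun r : ℝ => (r, y)) r := by fun_prop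
    exact ((ContinuousAt.comp (f := fun r : ℝ => (r, y)) (x := r) h1 h2).clm_apply
      continuousAt_const).continuousWithinAt
  · by_contra h
    exact hr' (hsupp (r, y) ⟨hr, hy⟩ h)

/-- The Sobolev inequality on the part of a cone over a ball: Hardy's inequality controls the
derivative of the cutoff in the cross section. -/
theorem lintegral_sobolev_cone_ball (ν : Measure F) [ν.IsAddHaarMeasure] {n : ℕ}
    (hn : 3 ≤ n) (hF : Module.finrank ℝ F + 1 = n) (y₀ : F) {ε : ℝ} (hε : 0 < ε) :
    ∃ C : ℝ≥0, ∀ v : ℝ × F → ℝ, ContDiffOn ℝ 1 v (Ioi 0 ×ˢ Metric.ball y₀ (3 * ε)) →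
      ∀ a b : ℝ, 0 < a →
      (∀ z ∈ Ioi (0 : ℝ) ×ˢ Metric.ball y₀ (3 * ε), v z ≠ 0 → z.1 ∈ Icc a b) →
      (∫⁻ z in Ioi (0 : ℝ) ×ˢ Metric.ball y₀ ε, ENNReal.ofReal (z.1 ^ (n - 1)) *
        ‖v z‖ₑ ^ (2 * (n : ℝ) / ((n : ℝ) - 2)) ∂(volume.prod ν)) ^ (((n : ℝ) - 2) / (n : ℝ)) ≤
      C * ∫⁻ z in Ioi (0 : ℝ) ×ˢ Metric.ball y₀ (3 * ε), ENNReal.ofReal (z.1 ^ (n - 1)) *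
        ENNReal.ofReal (coneEnergy v z) ∂(volume.prod ν) := by
  have hR : 0 ≤ ‖y₀‖ + 2 * ε := by positivity
  obtain ⟨C, hC⟩ := lintegral_sobolev_cone_coordinates ν hn hF hR
  -- a cutoff in the cross section: `1` on the ball of radius `ε`, supported in that of radius `2 ε`
  let χ : ContDiffBump y₀ := ⟨ε, 2 * ε, hε, by linarith⟩
  have hχ : ContDiff ℝ 1 χ := χ.contDiff
  obtain ⟨M, hM⟩ : ∃ M, ∀ y, ‖fderiv ℝ χ y‖ ≤ M :=
    (hχ.continuous_fderiv one_ne_zero).bounded_above_of_compact_support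
      (χ.hasCompactSupport.fderiv (𝕜 := ℝ))
  refine ⟨C * (2 + 8 * (M ^ 2).toNNReal), fun v hv a b ha hsupp => ?_⟩
  set W := Metric.ball y₀ (3 * ε) with hW
  have hS : IsOpen (Ioi (0 : ℝ) ×ˢ W) := isOpen_Ioi.prod Metric.isOpen_ball
  have hT : IsOpen (Ioi (0 : ℝ) ×ˢ (univ : Set F)) := isOpen_Ioi.prod isOpen_univ
  have hχ0 : ∀ y, χ y ≠ 0 → dist y y₀ < 2 * ε := by
    intro y h
    have : y ∈ Function.support χ := h
    rwa [χ.support_eq] at this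
  set f : ℝ × F → ℝ := fun z => χ z.2 * v z with hf
  have hf0 : ∀ z : ℝ × F, z.2 ∉ W → f =ᶠ[𝓝 z] fun _ => 0 := by
    intro z hz
    have h1 : 2 * ε < dist z.2 y₀ := by
      rw [hW, Metric.mem_ball, not_lt] at hz; linarith
    have h2 : ContinuousAt (fun z : ℝ × F => dist z.2 y₀) z := by fun_prop
    filter_upwards [h2.eventually_const_lt h1] with y hy
    simp only [hf]
    rw [show χ y.2 = 0 by by_contra h; exact absurd (hχ0 _ h) (not_lt.2 hy.le), zero_mul]
  have hf1 : ContDiffOn ℝ 1 f (Ioi 0 ×ˢ univ) := by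
    intro z hz
    refine ContDiffAt.contDiffWithinAt ?_
    by_cases hzW : z.2 ∈ W
    · exact (hχ.contDiffAt.comp z contDiffAt_snd).mul (hv.contDiffAt (hS.mem_nhds ⟨hz.1, hzW⟩))
    · exact contDiffAt_const.congr_of_eventuallyEq (hf0 z hzW)
  have hfs : ∀ z : ℝ × F, 0 < z.1 → f z ≠ 0 → z.1 ∈ Icc a b ∧ ‖z.2‖ ≤ ‖y₀‖ + 2 * ε := by
    intro z hz h
    have h1 := hχ0 z.2 (left_ne_zero_of_mul h)
    refine ⟨hsupp z ⟨hz, ?_⟩ (right_ne_zero_of_mul h), ?_⟩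
    · rw [hW, Metric.mem_ball]; linarith
    · rw [dist_eq_norm] at h1
      have := norm_le_norm_add_norm_sub' z.2 y₀
      linarith
  have h := hC f hf1 a b ha hfs
  have hL : ∫⁻ z in Ioi (0 : ℝ) ×ˢ Metric.ball y₀ ε, ENNReal.ofReal (z.1 ^ (n - 1)) *
        ‖v z‖ₑ ^ (2 * (n : ℝ) / ((n : ℝ) - 2)) ∂(volume.prod ν) ≤
      ∫⁻ z in Ioi (0 : ℝ) ×ˢ univ, ENNReal.ofReal (z.1 ^ (n - 1)) *
        ‖f z‖ₑ ^ (2 * (n : ℝ) / ((n : ℝ) - 2)) ∂(volume.prod ν) := by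
    refine (setLIntegral_congr_fun (measurableSet_Ioi.prod measurableSet_ball)
      fun z hz => ?_).trans_le (lintegral_mono_set (prod_mono_right (subset_univ _)))
    have : χ z.2 = 1 := χ.one_of_mem_closedBall (Metric.ball_subset_closedBall hz.2)
    simp only [hf]
    rw [this, one_mul]
  have hE : ∫⁻ z in Ioi (0 : ℝ) ×ˢ univ, ENNReal.ofReal (z.1 ^ (n - 1)) *
        ENNReal.ofReal (coneEnergy f z) ∂(volume.prod ν) ≤
      (2 + 8 * (M ^ 2).toNNReal) * ∫⁻ z in Ioi (0 : ℝ) ×ˢ W, ENNReal.ofReal (z.1 ^ (n - 1)) *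
        ENNReal.ofReal (coneEnergy v z) ∂(volume.prod ν) := by
    have hm := measurable_coneEnergy v
    calc _ ≤ ∫⁻ z in Ioi (0 : ℝ) ×ˢ W, ENNReal.ofReal (z.1 ^ (n - 1)) *
        ENNReal.ofReal (coneEnergy f z) ∂(volume.prod ν) := by
          refine setLIntegral_le_of_eq_zero hT.measurableSet hS.measurableSet fun z hz hz' => ?_
          rw [coneEnergy_eq_zero (hf0 z fun h => hz' ⟨hz.1, h⟩)]
          simp
      _ ≤ ∫⁻ z in Ioi (0 : ℝ) ×ˢ W, (2 * (ENNReal.ofReal (z.1 ^ (n - 1)) *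
          ENNReal.ofReal (coneEnergy v z)) + 2 * (M ^ 2).toNNReal *
          (ENNReal.ofReal (z.1 ^ (n - 1)) * ENNReal.ofReal ((z.1⁻¹ * v z) ^ 2)))
          ∂(volume.prod ν) := by
          refine setLIntegral_mono' hS.measurableSet fun z hz => ?_
          have h1 : coneEnergy f z ≤ _ := coneEnergy_mul_le
            ((hv.contDiffAt (hS.mem_nhds hz)).differentiableAt one_ne_zero)
            (hχ.differentiable one_ne_zero z.2)
            (by rw [abs_of_nonneg χ.nonneg]; exact χ.le_one) (hM z.2)
          calc _ ≤ ENNReal.ofReal (z.1 ^ (n - 1)) * ENNReal.ofReal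
                (2 * coneEnergy v z + 2 * M ^ 2 * (z.1⁻¹ * v z) ^ 2) := by gcongr
            _ = ENNReal.ofReal (z.1 ^ (n - 1)) * (2 * ENNReal.ofReal (coneEnergy v z) +
                2 * (M ^ 2).toNNReal * ENNReal.ofReal ((z.1⁻¹ * v z) ^ 2)) := by
              have := coneEnergy_nonneg v z
              rw [ENNReal.ofReal_add (by positivity) (by positivity),
                ENNReal.ofReal_mul (by positivity), ENNReal.ofReal_mul (by positivity),
                ENNReal.ofReal_mul (by positivity), ENNReal.ofReal_ofNat]
              rfl
            _ = _ := by ring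
      _ = 2 * (∫⁻ z in Ioi (0 : ℝ) ×ˢ W, ENNReal.ofReal (z.1 ^ (n - 1)) *
          ENNReal.ofReal (coneEnergy v z) ∂(volume.prod ν)) + 2 * (M ^ 2).toNNReal *
          ∫⁻ z in Ioi (0 : ℝ) ×ˢ W, (ENNReal.ofReal (z.1 ^ (n - 1)) *
            ENNReal.ofReal ((z.1⁻¹ * v z) ^ 2)) ∂(volume.prod ν) := by
          rw [lintegral_add_left (by fun_prop), lintegral_const_mul' _ _ (by norm_num),
            lintegral_const_mul' _ _ (by finiteness)]
      _ ≤ 2 * (∫⁻ z in Ioi (0 : ℝ) ×ˢ W, ENNReal.ofReal (z.1 ^ (n - 1)) *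
          ENNReal.ofReal (coneEnergy v z) ∂(volume.prod ν)) + 2 * (M ^ 2).toNNReal *
          (4 * ∫⁻ z in Ioi (0 : ℝ) ×ˢ W, ENNReal.ofReal (z.1 ^ (n - 1)) *
          ENNReal.ofReal (coneEnergy v z) ∂(volume.prod ν)) := by
          gcongr
          exact lintegral_hardy_cone ν (by omega) Metric.isOpen_ball hv ha hsupp
      _ = _ := by ring
  calc _ ≤ _ := by
        have : (3 : ℝ) ≤ n := by exact_mod_cast hn
        exact ENNReal.rpow_le_rpow hL (div_nonneg (by linarith) (by linarith))
    _ ≤ _ := h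
    _ ≤ _ := by
        rw [ENNReal.coe_mul, mul_assoc]
        push_cast
        gcongr

end ConeSobolev

/-! ### Riemannian volume in charts -/

section ChartVolume

variable {E H : Type*} [NormedAddCommGroup E] [NormedSpace ℝ E] [TopologicalSpace H]
  {I : ModelWithCorners ℝ E H}
  {M : Type*} [TopologicalSpace M] [ChartedSpace H M] [IsManifold I ∞ M]

/-- The bilinear form on the model space that represents `g` at the coordinate point `y` of the
preferred chart at `x₀`. -/
noncomputable def chartForm (g : SmoothMetric I M) (x₀ : M) (y : E) : LinearMap.BilinForm ℝ E :=
  (metricForm g ((extChartAt I x₀).symm y)).comp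
    (mfderiv 𝓘(ℝ, E) I (extChartAt I x₀).symm y : E →L[ℝ] _).toLinearMap
    (mfderiv 𝓘(ℝ, E) I (extChartAt I x₀).symm y : E →L[ℝ] _).toLinearMap

theorem chartForm_apply (g : SmoothMetric I M) (x₀ : M) (y v w : E) :
    chartForm g x₀ y v w = g.inner ((extChartAt I x₀).symm y)
      (mfderiv 𝓘(ℝ, E) I (extChartAt I x₀).symm y v)
      (mfderiv 𝓘(ℝ, E) I (extChartAt I x₀).symm y w) := rfl

theorem volumeDensity_eq {ι : Type*} [Fintype ι] [DecidableEq ι] [MeasurableSpace E] [BorelSpace E]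
    [MeasurableSpace M] (b : Module.Basis ι ℝ E) (g : SmoothMetric I M) (x₀ : M) (y : E) :
    volumeDensity b g x₀ y = √ (LinearMap.BilinForm.toMatrix b (chartForm g x₀ y)).det := by
  unfold volumeDensity
  refine congrArg (fun A : Matrix ι ι ℝ => √ A.det) (Matrix.ext fun i j => ?_)
  rw [LinearMap.BilinForm.toMatrix_apply]
  rfl

theorem chartVolume_le_riemannianVolume {ι : Type*} [Fintype ι] [DecidableEq ι]
    [MeasurableSpace E] [BorelSpace E] [MeasurableSpace M] (b : Module.Basis ι ℝ E)
    (g : SmoothMetric I M) (x₀ : M) :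
    chartVolume b g x₀ ≤ riemannianVolume b g :=
  le_iSup (fun x => chartVolume b g x) x₀

variable [I.Boundaryless]

theorem mdifferentiableAt_extChartAt_symm {x₀ : M} {y : E} (hy : y ∈ (extChartAt I x₀).target) :
    MDifferentiableAt 𝓘(ℝ, E) I (extChartAt I x₀).symm y := by
  have := mdifferentiableWithinAt_extChartAt_symm (I := I) hy
  rwa [I.range_eq_univ, mdifferentiableWithinAt_univ] at this

theorem differentiableAt_extChartAt_comp_symm {x₀ x₁ : M} {y : E}
    (hy : y ∈ (extChartAt I x₁).target)
    (hy' : (extChartAt I x₁).symm y ∈ (extChartAt I x₀).source) :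
    DifferentiableAt ℝ (extChartAt I x₀ ∘ (extChartAt I x₁).symm) y := by
  rw [← mdifferentiableAt_iff_differentiableAt]
  rw [extChartAt_source] at hy'
  exact (mdifferentiableAt_extChartAt hy').comp y (mdifferentiableAt_extChartAt_symm hy)

/-- The transformation law of the coordinate expression of a metric under a change of charts. -/
theorem chartForm_eq_comp (g : SmoothMetric I M) {x₀ x₁ : M} {y : E}
    (hy : y ∈ (extChartAt I x₁).target)
    (hy' : (extChartAt I x₁).symm y ∈ (extChartAt I x₀).source) :
    chartForm g x₁ y =
      (chartForm g x₀ (extChartAt I x₀ ((extChartAt I x₁).symm y))).comp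
        (fderiv ℝ (extChartAt I x₀ ∘ (extChartAt I x₁).symm) y).toLinearMap
        (fderiv ℝ (extChartAt I x₀ ∘ (extChartAt I x₁).symm) y).toLinearMap := by
  set τ := extChartAt I x₀ ∘ (extChartAt I x₁).symm with hτ
  have hτd := differentiableAt_extChartAt_comp_symm hy hy'
  have hd : ∀ v : E, (mfderiv 𝓘(ℝ, E) I (extChartAt I x₁).symm y v : E) =
      (mfderiv 𝓘(ℝ, E) I (extChartAt I x₀).symm (τ y) (fderiv ℝ τ y v) : E) := by
    intro v
    have hev : (extChartAt I x₁).symm =ᶠ[𝓝 y] (extChartAt I x₀).symm ∘ τ := by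
      have h1 : ContinuousAt (extChartAt I x₁).symm y := continuousAt_extChartAt_symm'' hy
      filter_upwards [h1.preimage_mem_nhds ((isOpen_extChartAt_source x₀).mem_nhds hy')] with z hz
      exact ((extChartAt I x₀).left_inv hz).symm
    have h2 : MDifferentiableAt 𝓘(ℝ, E) I (extChartAt I x₀).symm (τ y) :=
      mdifferentiableAt_extChartAt_symm ((extChartAt I x₀).map_source hy')
    have h3 := mfderiv_comp_apply y h2 (mdifferentiableAt_iff_differentiableAt.2 hτd) v
    rw [mfderiv_eq_fderiv] at h3
    rw [hev.mfderiv_eq]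
    exact h3
  have hp : (extChartAt I x₀).symm (τ y) = (extChartAt I x₁).symm y :=
    (extChartAt I x₀).left_inv hy'
  -- the base points are equal but not definitionally so; vectors are compared in the model space
  have key : ∀ (p q : M) (_ : p = q) (v w : E),
      (g.inner p : E →L[ℝ] E →L[ℝ] ℝ) v w = (g.inner q : E →L[ℝ] E →L[ℝ] ℝ) v w := by
    rintro p q rfl v w
    rfl
  refine LinearMap.ext₂ fun v w => ?_
  exact (key _ _ hp.symm _ _).trans (congrArg₂
    (fun a b : E => (g.inner ((extChartAt I x₀).symm (τ y)) : E →L[ℝ] E →L[ℝ] ℝ) a b)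
    (hd v) (hd w))

variable {ι : Type*} [Fintype ι] [DecidableEq ι] [MeasurableSpace E] [BorelSpace E]
  [MeasurableSpace M]

/-- The transformation law of the volume density: the Gram matrix changes by `G ↦ Jᵀ G J`. -/
theorem volumeDensity_eq_abs_det_mul (b : Module.Basis ι ℝ E) (g : SmoothMetric I M) {x₀ x₁ : M}
    {y : E} (hy : y ∈ (extChartAt I x₁).target)
    (hy' : (extChartAt I x₁).symm y ∈ (extChartAt I x₀).source) :
    volumeDensity b g x₁ y =
      |(fderiv ℝ (extChartAt I x₀ ∘ (extChartAt I x₁).symm) y).det| *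
        volumeDensity b g x₀ (extChartAt I x₀ ((extChartAt I x₁).symm y)) := by
  rw [volumeDensity_eq, volumeDensity_eq, chartForm_eq_comp g hy hy',
    LinearMap.BilinForm.toMatrix_comp b b, Matrix.det_mul, Matrix.det_mul, Matrix.det_transpose,
    LinearMap.det_toMatrix, mul_comm, ← mul_assoc, Real.sqrt_mul (mul_self_nonneg _),
    Real.sqrt_mul_self_eq_abs]

variable [BorelSpace M]

omit [IsManifold I ∞ M] in
theorem measurableSet_target_inter_preimage (x₀ : M) {A : Set M} (hA : MeasurableSet A) :
    MeasurableSet ((extChartAt I x₀).target ∩ (extChartAt I x₀).symm ⁻¹' A) := by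
  have ht : MeasurableSet (extChartAt I x₀).target := (isOpen_extChartAt_target x₀).measurableSet
  have h := ht.subtype_image ((continuousOn_iff_continuous_domRestrict.1
    (continuousOn_extChartAt_symm (I := I) x₀)).measurable hA)
  convert h using 1
  ext y
  constructor
  · exact fun hy => ⟨⟨y, hy.1⟩, hy.2, rfl⟩
  · rintro ⟨z, hz, rfl⟩
    exact ⟨z.2, hz⟩

theorem chartVolume_apply (b : Module.Basis ι ℝ E) (g : SmoothMetric I M) (x₀ : M) {A : Set M}
    (hA : MeasurableSet A) :
    chartVolume b g x₀ A = ∫⁻ y in (extChartAt I x₀).target ∩ (extChartAt I x₀).symm ⁻¹' A,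
      ENNReal.ofReal (volumeDensity b g x₀ y) ∂b.addHaar := by
  rw [chartVolume, Measure.map_apply_of_aemeasurable
    (((continuousOn_extChartAt_symm x₀).aemeasurable
      (isOpen_extChartAt_target x₀).measurableSet).mono_ac
      (withDensity_absolutelyContinuous _ _)) hA,
    withDensity_apply', Measure.restrict_restrict' (isOpen_extChartAt_target x₀).measurableSet,
    inter_comm]

variable [FiniteDimensional ℝ E]

/-- The measures `√ det (g_ij) dy` of two charts agree on the overlap, by the change of variables
formula. -/
theorem chartVolume_apply_eq_of_subset (b : Module.Basis ι ℝ E) (g : SmoothMetric I M) (x₀ x₁ : M)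
    {A : Set M} (hA : MeasurableSet A) (h₀ : A ⊆ (extChartAt I x₀).source)
    (h₁ : A ⊆ (extChartAt I x₁).source) : chartVolume b g x₁ A = chartVolume b g x₀ A := by
  rw [chartVolume_apply b g x₀ hA, chartVolume_apply b g x₁ hA]
  set τ := extChartAt I x₀ ∘ (extChartAt I x₁).symm with hτ
  set S := (extChartAt I x₁).target ∩ (extChartAt I x₁).symm ⁻¹' A with hS
  have himg : (extChartAt I x₀).target ∩ (extChartAt I x₀).symm ⁻¹' A = τ '' S := by
    ext z
    constructor
    · rintro ⟨hz, hzA⟩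
      refine ⟨extChartAt I x₁ ((extChartAt I x₀).symm z),
        ⟨(extChartAt I x₁).map_source (h₁ hzA), ?_⟩, ?_⟩
      · rw [mem_preimage, (extChartAt I x₁).left_inv (h₁ hzA)]
        exact hzA
      · simp only [hτ, Function.comp_apply]
        rw [(extChartAt I x₁).left_inv (h₁ hzA), (extChartAt I x₀).right_inv hz]
    · rintro ⟨y, ⟨hy, hyA⟩, rfl⟩
      refine ⟨(extChartAt I x₀).map_source (h₀ hyA), ?_⟩
      simp only [hτ, Function.comp_apply, mem_preimage]
      rw [(extChartAt I x₀).left_inv (h₀ hyA)]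
      exact hyA
  have hinj : InjOn τ S := by
    rintro y ⟨hy, hyA⟩ z ⟨hz, hzA⟩ hyz
    have := (extChartAt I x₀).injOn (h₀ hyA) (h₀ hzA) hyz
    exact (extChartAt I x₁).symm.injOn hy hz this
  rw [himg, lintegral_image_eq_lintegral_abs_det_fderiv_mul _
    (measurableSet_target_inter_preimage x₁ hA) (fun y hy =>
      (differentiableAt_extChartAt_comp_symm hy.1 (h₀ hy.2)).hasFDerivAt.hasFDerivWithinAt) hinj]
  refine setLIntegral_congr_fun (measurableSet_target_inter_preimage x₁ hA) fun y hy => ?_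
  rw [volumeDensity_eq_abs_det_mul b g hy.1 (h₀ hy.2), ENNReal.ofReal_mul (abs_nonneg _)]
  rfl

/-- The Riemannian volume is at most `√ det (g_ij) dy` on the domain of a chart. -/
theorem riemannianVolume_restrict_source_le (b : Module.Basis ι ℝ E) (g : SmoothMetric I M)
    (x₀ : M) :
    (riemannianVolume b g).restrict (extChartAt I x₀).source ≤ chartVolume b g x₀ := by
  set S := (extChartAt I x₀).source with hS
  have hSm : MeasurableSet S := (isOpen_extChartAt_source x₀).measurableSet
  -- the measure `⊤` off `S` absorbs what the other charts contribute there
  have h : riemannianVolume b g ≤ chartVolume b g x₀ + (⊤ : Measure M).restrict Sᶜ := by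
    refine iSup_le fun x₁ => Measure.le_iff.2 fun A hA => ?_
    rw [Measure.add_apply, Measure.restrict_apply hA, ← measure_inter_add_sdiff A hSm]
    refine add_le_add ?_ (le_top (a := chartVolume b g x₁) _)
    set T := (extChartAt I x₁).source with hT
    have hTm : MeasurableSet T := (isOpen_extChartAt_source x₁).measurableSet
    have h0 : chartVolume b g x₁ Tᶜ = 0 := by
      rw [chartVolume_apply b g x₁ hTm.compl]
      convert setLIntegral_empty _ using 3
      ext y
      simp only [mem_inter_iff, mem_preimage, mem_compl_iff, mem_empty_iff_false, iff_false,
        not_and, not_not]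
      exact fun hy => (extChartAt I x₁).map_target hy
    have h1 : chartVolume b g x₁ (A ∩ S) ≤ chartVolume b g x₁ (A ∩ S ∩ T) := by
      rw [← measure_inter_add_sdiff (A ∩ S) hTm, measure_mono_null (s := (A ∩ S) \ T)
        (fun x hx => hx.2) h0, add_zero]
    refine h1.trans ?_
    rw [chartVolume_apply_eq_of_subset b g x₀ x₁ ((hA.inter hSm).inter hTm) (fun x hx => hx.1.2)
      fun x hx => hx.2]
    exact measure_mono fun x hx => hx.1.1
  refine (Measure.restrict_mono le_rfl h).trans ?_
  rw [Measure.restrict_add, Measure.restrict_restrict hSm, inter_compl_self,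
    Measure.restrict_empty, add_zero]
  exact Measure.restrict_le_self

end ChartVolume

/-! ### Comparison of metrics, gradients and determinants -/

section Gradient

variable {E H : Type*} [NormedAddCommGroup E] [NormedSpace ℝ E] [TopologicalSpace H]
  {I : ModelWithCorners ℝ E H}
  {M : Type*} [TopologicalSpace M] [ChartedSpace H M] [IsManifold I ∞ M]

theorem SmoothMetric.inner_self_nonneg (g : SmoothMetric I M) (x : M) (v : TangentSpace I x) :
    0 ≤ g.inner x v v := by
  by_cases hv : v = 0
  · rw [hv, map_zero]
  · exact (g.pos x v hv).le

theorem chartForm_isSymm (g : SmoothMetric I M) (x₀ : M) (y : E) : (chartForm g x₀ y).IsSymm :=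
  ⟨fun _ _ => g.symm _ _ _⟩

/-- The Cauchy-Schwarz inequality `du(w)² ≤ |∇_g u|_g² |w|_g²`. -/
theorem sq_mfderiv_le_gradientNormSq_mul [FiniteDimensional ℝ E] (g : SmoothMetric I M)
    (u : M → ℝ) (x : M) (w : TangentSpace I x) {c : ℝ} (hc : mfderiv I 𝓘(ℝ, ℝ) u x w = c) :
    c ^ 2 ≤ gradientNormSq g u x * g.inner x w w := by
  have h1 : c = metricForm g x (riemannianGradient g u x) w :=
    hc.symm.trans (LinearMap.BilinForm.apply_toDual_symm_apply (hB := metricForm_nondegenerate g x)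
      (mfderiv I 𝓘(ℝ, ℝ) u x : TangentSpace I x →L[ℝ] ℝ).toLinearMap w).symm
  rw [h1]
  exact LinearMap.BilinForm.apply_sq_le_of_symm (metricForm g x)
    (fun v => g.inner_self_nonneg x v) ⟨fun v w => g.symm x v w⟩ _ _

/-- In the trivialization of the tangent bundle at `x`, a metric is comparable near `x` with a
norm of the model space. -/
theorem eventually_inner_symmL_bounds (g : SmoothMetric I M) (x : M) :
    ∃ C : ℝ, 0 < C ∧ ∀ᶠ p in 𝓝 x, ∀ η : E,
      C⁻¹ * ‖η‖ ^ 2 ≤ g.inner p ((trivializationAt E (TangentSpace I) x).symmL ℝ p η)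
        ((trivializationAt E (TangentSpace I) x).symmL ℝ p η) ∧
      g.inner p ((trivializationAt E (TangentSpace I) x).symmL ℝ p η)
        ((trivializationAt E (TangentSpace I) x).symmL ℝ p η) ≤ C * ‖η‖ ^ 2 := by
  let _ : RiemannianBundle (fun x : M => TangentSpace I x) := ⟨g.toRiemannianMetric⟩
  have : IsContinuousRiemannianBundle E (fun x : M => TangentSpace I x) :=
    ⟨⟨g.inner, g.contMDiff.continuous, fun _ _ _ => rfl⟩⟩
  set e := trivializationAt E (TangentSpace I : M → Type _) x with he
  obtain ⟨C₁, hC₁, h₁⟩ := eventually_norm_trivializationAt_lt E (fun x : M => TangentSpace I x) x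
  obtain ⟨C₂, hC₂, h₂⟩ := eventually_norm_symmL_trivializationAt_lt E
    (fun x : M => TangentSpace I x) x
  have hnorm : ∀ (p : M) (v : TangentSpace I p), g.inner p v v = ‖v‖ ^ 2 := fun p v =>
    real_inner_self_eq_norm_sq v
  refine ⟨max (C₁ ^ 2) (C₂ ^ 2), by positivity, ?_⟩
  filter_upwards [h₁, h₂, e.open_baseSet.mem_nhds (FiberBundle.mem_baseSet_trivializationAt' x)]
    with p h1 h2 hp η
  rw [hnorm]
  constructor
  · have h3 : e.continuousLinearMapAt ℝ p (e.symmL ℝ p η) = η :=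
      e.continuousLinearMapAt_symmL hp η
    have h4 : ‖η‖ ≤ C₁ * ‖e.symmL ℝ p η‖ := by
      conv_lhs => rw [← h3]
      refine (ContinuousLinearMap.le_opNorm _ _).trans ?_
      gcongr
    rw [inv_mul_le_iff₀ (by positivity)]
    calc ‖η‖ ^ 2 ≤ (C₁ * ‖e.symmL ℝ p η‖) ^ 2 := by gcongr
      _ = C₁ ^ 2 * ‖e.symmL ℝ p η‖ ^ 2 := mul_pow _ _ _
      _ ≤ _ := by gcongr; exact le_max_left _ _
  · have h4 : ‖e.symmL ℝ p η‖ ≤ C₂ * ‖η‖ := by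
      refine (ContinuousLinearMap.le_opNorm _ _).trans ?_
      gcongr
    calc ‖e.symmL ℝ p η‖ ^ 2 ≤ (C₂ * ‖η‖) ^ 2 := by gcongr
      _ = C₂ ^ 2 * ‖η‖ ^ 2 := mul_pow _ _ _
      _ ≤ _ := by gcongr; exact le_max_right _ _

/-- In the preferred chart at `x`, a metric is comparable near `x` with a constant metric. -/
theorem eventually_chartForm_bounds [I.Boundaryless] (g : SmoothMetric I M) (x : M) :
    ∃ C : ℝ, 0 < C ∧ ∀ᶠ y in 𝓝 (extChartAt I x x), ∀ η : E,
      C⁻¹ * ‖η‖ ^ 2 ≤ chartForm g x y η η ∧ chartForm g x y η η ≤ C * ‖η‖ ^ 2 := by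
  obtain ⟨C, hC, h⟩ := eventually_inner_symmL_bounds g x
  refine ⟨C, hC, ?_⟩
  set P : M → Prop := fun p => ∀ η : E,
      C⁻¹ * ‖η‖ ^ 2 ≤ g.inner p ((trivializationAt E (TangentSpace I) x).symmL ℝ p η)
        ((trivializationAt E (TangentSpace I) x).symmL ℝ p η) ∧
      g.inner p ((trivializationAt E (TangentSpace I) x).symmL ℝ p η)
        ((trivializationAt E (TangentSpace I) x).symmL ℝ p η) ≤ C * ‖η‖ ^ 2 with hP
  have hx : ∀ᶠ p in 𝓝 x, P p := h
  have hc : ContinuousAt (extChartAt I x).symm (extChartAt I x x) := continuousAt_extChartAt_symm x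
  rw [← (extChartAt I x).left_inv (mem_extChartAt_source (I := I) x)] at hx
  filter_upwards [hc.eventually hx, extChartAt_target_mem_nhds x] with y hy hyt η
  have hs : (extChartAt I x).symm y ∈ (chartAt H x).source := by
    rw [← extChartAt_source I]; exact (extChartAt I x).map_target hyt
  have h3 : (mfderiv 𝓘(ℝ, E) I (extChartAt I x).symm y η : E) =
      ((trivializationAt E (TangentSpace I) x).symmL ℝ ((extChartAt I x).symm y) η : E) := by
    rw [TangentBundle.symmL_trivializationAt hs, I.range_eq_univ, mfderivWithin_univ,
      (extChartAt I x).right_inv hyt]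
    rfl
  have h4 : chartForm g x y η η =
      g.inner _ ((trivializationAt E (TangentSpace I) x).symmL ℝ ((extChartAt I x).symm y) η)
        ((trivializationAt E (TangentSpace I) x).symmL ℝ ((extChartAt I x).symm y) η) :=
    congrArg (fun a : E => (g.inner ((extChartAt I x).symm y) : E →L[ℝ] E →L[ℝ] ℝ) a a) h3
  rw [h4]
  exact hy η

end Gradient

section Determinant

/-- A symmetric matrix whose quadratic form lies between `c |x|²` and `C |x|²` has its determinant
between the corresponding powers, as all eigenvalues lie in `[c, C]`. -/
theorem Matrix.IsHermitian.pow_card_le_det {ι : Type*} [Fintype ι] [DecidableEq ι]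
    {A : Matrix ι ι ℝ} (hA : A.IsHermitian) {c C : ℝ} (hc : 0 ≤ c)
    (h : ∀ x : ι → ℝ, c * x ⬝ᵥ x ≤ x ⬝ᵥ A.mulVec x ∧ x ⬝ᵥ A.mulVec x ≤ C * x ⬝ᵥ x) :
    c ^ Fintype.card ι ≤ A.det ∧ A.det ≤ C ^ Fintype.card ι := by
  have he : ∀ i, c ≤ hA.eigenvalues i ∧ hA.eigenvalues i ≤ C := by
    intro i
    have h1 := h (hA.eigenvectorBasis i)
    have h2 : (hA.eigenvectorBasis i).ofLp ⬝ᵥ (hA.eigenvectorBasis i).ofLp = 1 := by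
      have := hA.eigenvectorBasis.orthonormal.1 i
      have h3 := EuclideanSpace.real_norm_sq_eq (hA.eigenvectorBasis i)
      rw [this] at h3
      simp only [dotProduct, ← pow_two]
      linarith
    have h3 := hA.eigenvalues_eq i
    simp only [star_trivial, RCLike.re_to_real] at h3
    rw [← h3, h2, mul_one, mul_one] at h1
    exact h1
  have hd := hA.det_eq_prod_eigenvalues
  simp only [RCLike.ofReal_real_eq_id, id_eq] at hd
  rw [hd]
  constructor
  · calc c ^ Fintype.card ι = ∏ _i : ι, c := by simp
      _ ≤ _ := Finset.prod_le_prod (fun _ _ => hc) fun i _ => (he i).1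
  · calc _ ≤ ∏ _i : ι, C := Finset.prod_le_prod (fun i _ => hc.trans (he i).1) fun i _ => (he i).2
      _ = _ := by simp

theorem det_toMatrix_coneBasis_bounds {k : ℕ}
    {B : LinearMap.BilinForm ℝ (ℝ × EuclideanSpace ℝ (Fin k))} (hB : B.IsSymm) {c C : ℝ}
    (hc : 0 ≤ c) (h : ∀ (a : ℝ) (η : EuclideanSpace ℝ (Fin k)),
      c * (a ^ 2 + ‖η‖ ^ 2) ≤ B (a, η) (a, η) ∧ B (a, η) (a, η) ≤ C * (a ^ 2 + ‖η‖ ^ 2)) :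
    c ^ (k + 1) ≤ (LinearMap.BilinForm.toMatrix (coneBasis k) B).det ∧
      (LinearMap.BilinForm.toMatrix (coneBasis k) B).det ≤ C ^ (k + 1) := by
  have hH : (LinearMap.BilinForm.toMatrix (coneBasis k) B).IsHermitian := by
    refine Matrix.IsHermitian.ext fun i j => ?_
    rw [LinearMap.BilinForm.toMatrix_apply, LinearMap.BilinForm.toMatrix_apply, star_trivial]
    exact hB.eq _ _
  have hcard : Fintype.card (Unit ⊕ Fin k) = k + 1 := by simp [add_comm]
  rw [← hcard]
  refine hH.pow_card_le_det hc fun x => ?_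
  rw [LinearMap.BilinForm.dotProduct_toMatrix_mulVec]
  set z := (coneBasis k).equivFun.symm x with hz
  have hx : x ⬝ᵥ x = z.1 ^ 2 + ‖z.2‖ ^ 2 := by
    have hxz : x = (coneBasis k).equivFun z := by rw [hz, LinearEquiv.apply_symm_apply]
    rw [EuclideanSpace.real_norm_sq_eq, hxz]
    simp [dotProduct, coneBasis, pow_two, Module.Basis.singleton]
  rw [hx]
  exact h z.1 z.2

/-- If a scalar product on `ℝ × ℝᵏ` is comparable with `a² + r² |η|²`, then its volume density is
comparable with `r ^ k`. -/
theorem sqrt_det_toMatrix_coneBasis_bounds {k : ℕ}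
    {B : LinearMap.BilinForm ℝ (ℝ × EuclideanSpace ℝ (Fin k))} (hB : B.IsSymm) {c C r : ℝ}
    (hc : 0 ≤ c) (hr : 0 < r) (h : ∀ (a : ℝ) (η : EuclideanSpace ℝ (Fin k)),
      c * (a ^ 2 + r ^ 2 * ‖η‖ ^ 2) ≤ B (a, η) (a, η) ∧
        B (a, η) (a, η) ≤ C * (a ^ 2 + r ^ 2 * ‖η‖ ^ 2)) :
    √(c ^ (k + 1)) * r ^ k ≤ √(LinearMap.BilinForm.toMatrix (coneBasis k) B).det ∧
      √(LinearMap.BilinForm.toMatrix (coneBasis k) B).det ≤ √(C ^ (k + 1)) * r ^ k := by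
  -- rescaling the directions of the link by `r⁻¹` reduces to the case `r = 1`
  set S : ℝ × EuclideanSpace ℝ (Fin k) →ₗ[ℝ] ℝ × EuclideanSpace ℝ (Fin k) :=
    LinearMap.prodMap LinearMap.id (r⁻¹ • LinearMap.id) with hS
  have hSd : LinearMap.det S = r⁻¹ ^ k := by
    rw [hS, LinearMap.det_prodMap, LinearMap.det_smul]
    simp
  have h1 := det_toMatrix_coneBasis_bounds (B := B.comp S S) ⟨fun v w => hB.eq (S v) (S w)⟩ hc
    (C := C) fun a η => by
      have h2 := h a (r⁻¹ • η)
      rw [norm_smul, norm_inv, Real.norm_of_nonneg hr.le, mul_pow, ← mul_assoc, ← mul_pow,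
        mul_inv_cancel₀ hr.ne', one_pow, one_mul] at h2
      exact h2
  rw [LinearMap.BilinForm.toMatrix_comp (coneBasis k) (coneBasis k), Matrix.det_mul,
    Matrix.det_mul, Matrix.det_transpose, LinearMap.det_toMatrix, hSd] at h1
  set D := (LinearMap.BilinForm.toMatrix (coneBasis k) B).det
  have hD : √D = √(r⁻¹ ^ k * D * r⁻¹ ^ k) * r ^ k := by
    rw [show r⁻¹ ^ k * D * r⁻¹ ^ k = (r⁻¹ ^ k) ^ 2 * D by ring, Real.sqrt_mul (sq_nonneg _),
      Real.sqrt_sq (by positivity), mul_comm (r⁻¹ ^ k), mul_assoc, ← mul_pow,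
      inv_mul_cancel₀ hr.ne', one_pow, mul_one]
  rw [hD]
  constructor
  · gcongr
    exact h1.1
  · gcongr
    exact h1.2

theorem coneBasis_addHaar (k : ℕ) : (coneBasis k).addHaar =
    (volume : Measure ℝ).prod (volume : Measure (EuclideanSpace ℝ (Fin k))) := by
  have h1 : (Module.Basis.singleton Unit ℝ).addHaar = (volume : Measure ℝ) := by
    have h := (OrthonormalBasis.singleton Unit ℝ).addHaar_eq_volume
    rwa [OrthonormalBasis.toBasis_singleton] at h
  rw [coneBasis, Module.Basis.prod_addHaar, h1, OrthonormalBasis.addHaar_eq_volume]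

end Determinant

/-! ### Product charts of the cone -/

section ConeChart

variable {k : ℕ} {L : Type*} [TopologicalSpace L] [ChartedSpace (EuclideanSpace ℝ (Fin k)) L]

theorem extChartAt_posReals_target (t : posReals) : (extChartAt 𝓘(ℝ, ℝ) t).target = Ioi 0 := by
  ext x
  simp [extChartAt, TopologicalSpace.Opens.chartAt_eq, chartAt_self_eq,
    OpenPartialHomeomorph.subtypeRestr]
  rfl

theorem coe_extChartAt_posReals_symm (t : posReals) {r : ℝ} (hr : 0 < r) :
    (((extChartAt 𝓘(ℝ, ℝ) t).symm r : posReals) : ℝ) = r := by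
  have := (extChartAt 𝓘(ℝ, ℝ) t).right_inv (x := r) (by rw [extChartAt_posReals_target]; exact hr)
  simpa [TopologicalSpace.Opens.chartAt_eq, chartAt_self_eq] using this

theorem extChartAt_cone_target (p : Cone L) :
    (extChartAt (coneModel k) p).target = Ioi 0 ×ˢ (extChartAt (𝓡 k) p.2).target := by
  rw [extChartAt_prod, PartialEquiv.prod_target, extChartAt_posReals_target]

theorem extChartAt_cone_source (p : Cone L) :
    (extChartAt (coneModel k) p).source = univ ×ˢ (extChartAt (𝓡 k) p.2).source := by
  rw [extChartAt_prod, PartialEquiv.prod_source]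
  congr 1
  simp [extChartAt, TopologicalSpace.Opens.chartAt_eq, chartAt_self_eq,
    OpenPartialHomeomorph.subtypeRestr]

theorem radius_extChartAt_cone_symm (p : Cone L) {z : ℝ × EuclideanSpace ℝ (Fin k)}
    (hz : 0 < z.1) : Cone.radius ((extChartAt (coneModel k) p).symm z) = z.1 := by
  rw [extChartAt_prod]
  exact coe_extChartAt_posReals_symm p.1 hz

theorem extChartAt_cone_symm_snd (p : Cone L) (z : ℝ × EuclideanSpace ℝ (Fin k)) :
    ((extChartAt (coneModel k) p).symm z).2 = (extChartAt (𝓡 k) p.2).symm z.2 := by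
  rw [extChartAt_prod]
  rfl

variable [IsManifold (𝓡 k) ∞ L]

/-- In product charts the cone metric is `dr² + r² h`. -/
theorem chartForm_coneMetric (h : SmoothMetric (𝓡 k) L) (p : Cone L)
    {z : ℝ × EuclideanSpace ℝ (Fin k)} (hz : z ∈ (extChartAt (coneModel k) p).target)
    (v : ℝ × EuclideanSpace ℝ (Fin k)) :
    chartForm (coneMetric h) p z v v = v.1 ^ 2 + z.1 ^ 2 * chartForm h p.2 z.2 v.2 v.2 := by
  set φ := extChartAt (coneModel k) p with hφ
  have hz' := hz
  rw [hφ, extChartAt_cone_target] at hz'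
  have hz1 : 0 < z.1 := hz'.1
  have hd : MDifferentiableAt 𝓘(ℝ, ℝ × EuclideanSpace ℝ (Fin k)) (coneModel k) φ.symm z :=
    mdifferentiableAt_extChartAt_symm hz
  have h1 : Cone.dr k (φ.symm z)
      (mfderiv 𝓘(ℝ, ℝ × EuclideanSpace ℝ (Fin k)) (coneModel k) φ.symm z v) = v.1 := by
    have hr : MDifferentiableAt (coneModel k) 𝓘(ℝ, ℝ) (Cone.radius : Cone L → ℝ) (φ.symm z) :=
      (Cone.contMDiff_radius (k := k) (L := L)).mdifferentiableAt (by simp)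
    have hev : Cone.radius ∘ φ.symm =ᶠ[𝓝 z] Prod.fst := by
      filter_upwards [(isOpen_Ioi.preimage continuous_fst).mem_nhds hz1] with y hy
      exact radius_extChartAt_cone_symm p hy
    have h2 := mfderiv_comp_apply z hr hd v
    rw [hev.mfderiv_eq, mfderiv_eq_fderiv, fderiv_fst] at h2
    exact h2.symm
  have h2 : (Cone.dlink k (φ.symm z)
      (mfderiv 𝓘(ℝ, ℝ × EuclideanSpace ℝ (Fin k)) (coneModel k) φ.symm z v) :
        EuclideanSpace ℝ (Fin k)) =
      mfderiv 𝓘(ℝ, EuclideanSpace ℝ (Fin k)) (𝓡 k) (extChartAt (𝓡 k) p.2).symm z.2 v.2 := by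
    have hs : MDifferentiableAt (coneModel k) (𝓡 k) (Prod.snd : Cone L → L) (φ.symm z) :=
      mdifferentiableAt_snd
    have hev : (Prod.snd : Cone L → L) ∘ φ.symm = (extChartAt (𝓡 k) p.2).symm ∘ Prod.snd :=
      funext fun y => extChartAt_cone_symm_snd p y
    have hd2 : MDifferentiableAt 𝓘(ℝ, EuclideanSpace ℝ (Fin k)) (𝓡 k)
        (extChartAt (𝓡 k) p.2).symm (Prod.snd z) := mdifferentiableAt_extChartAt_symm hz'.2
    have hd3 : MDifferentiableAt 𝓘(ℝ, ℝ × EuclideanSpace ℝ (Fin k))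
        𝓘(ℝ, EuclideanSpace ℝ (Fin k)) Prod.snd z :=
      mdifferentiableAt_iff_differentiableAt.2 differentiableAt_snd
    have h3 := mfderiv_comp_apply z hs hd v
    have h4 := mfderiv_comp_apply z hd2 hd3 v
    rw [mfderiv_eq_fderiv, fderiv_snd] at h4
    rw [hev] at h3
    exact h3.symm.trans h4
  -- the base points are equal but not definitionally so; vectors are compared in the model space
  have key : ∀ (a b : L) (_ : a = b) (v : EuclideanSpace ℝ (Fin k)),
      (h.inner a : EuclideanSpace ℝ (Fin k) →L[ℝ] EuclideanSpace ℝ (Fin k) →L[ℝ] ℝ) v v =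
      (h.inner b : EuclideanSpace ℝ (Fin k) →L[ℝ] EuclideanSpace ℝ (Fin k) →L[ℝ] ℝ) v v := by
    rintro a b rfl v
    rfl
  have h3 : h.inner (φ.symm z).2
      (Cone.dlink k (φ.symm z)
        (mfderiv 𝓘(ℝ, ℝ × EuclideanSpace ℝ (Fin k)) (coneModel k) φ.symm z v))
      (Cone.dlink k (φ.symm z)
        (mfderiv 𝓘(ℝ, ℝ × EuclideanSpace ℝ (Fin k)) (coneModel k) φ.symm z v)) =
      chartForm h p.2 z.2 v.2 v.2 :=
    (key _ _ (extChartAt_cone_symm_snd p z) _).trans (congrArg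
      (fun a : EuclideanSpace ℝ (Fin k) => (h.inner ((extChartAt (𝓡 k) p.2).symm z.2) :
        EuclideanSpace ℝ (Fin k) →L[ℝ] EuclideanSpace ℝ (Fin k) →L[ℝ] ℝ) a a) h2)
  rw [chartForm_apply]
  change Cone.metricInner h _ _ _ = _
  rw [Cone.metricInner_apply, h1, h3, radius_extChartAt_cone_symm p hz1]
  ring

/-- In product charts near a ray, a metric uniformly equivalent to a cone metric is comparable with
`dr² + r² |dy|²`, uniformly along the ray. -/
theorem exists_chartForm_cone_bounds (h : SmoothMetric (𝓡 k) L)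
    {g : SmoothMetric (coneModel k) (Cone L)} (hg : UniformlyEquivalent g (coneMetric h))
    (p : Cone L) :
    ∃ C : ℝ, 0 < C ∧ ∃ ε : ℝ, 0 < ε ∧
      Metric.ball (extChartAt (𝓡 k) p.2 p.2) (3 * ε) ⊆ (extChartAt (𝓡 k) p.2).target ∧
      ∀ z ∈ Ioi (0 : ℝ) ×ˢ Metric.ball (extChartAt (𝓡 k) p.2 p.2) (3 * ε),
        ∀ (a : ℝ) (η : EuclideanSpace ℝ (Fin k)),
          C⁻¹ * (a ^ 2 + z.1 ^ 2 * ‖η‖ ^ 2) ≤ chartForm g p z (a, η) (a, η) ∧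
          chartForm g p z (a, η) (a, η) ≤ C * (a ^ 2 + z.1 ^ 2 * ‖η‖ ^ 2) := by
  obtain ⟨C₁, hC₁, h₁⟩ := hg
  obtain ⟨C₂, hC₂, h₂⟩ := eventually_chartForm_bounds h p.2
  obtain ⟨ε, hε, hball⟩ := Metric.mem_nhds_iff.1
    (Filter.inter_mem h₂ (extChartAt_target_mem_nhds (I := 𝓡 k) p.2))
  set D := max 1 C₂ with hD
  have hD1 : 1 ≤ D := le_max_left _ _
  have hD0 : 0 < D := by positivity
  refine ⟨C₁ * D, by positivity, ε / 3, by positivity, ?_, ?_⟩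
  · rw [mul_div_cancel₀ _ (by norm_num)]
    exact fun y hy => (hball hy).2
  rw [mul_div_cancel₀ _ (by norm_num)]
  rintro z ⟨hz1, hz2⟩ a η
  obtain ⟨hb, hzt⟩ := hball hz2
  have hz : z ∈ (extChartAt (coneModel k) p).target := by
    rw [extChartAt_cone_target]; exact ⟨hz1, hzt⟩
  have hc := chartForm_coneMetric h p hz (a, η)
  simp only at hc
  obtain ⟨hb1, hb2⟩ := hb η
  obtain ⟨h3, h4⟩ : C₁⁻¹ * chartForm (coneMetric h) p z (a, η) (a, η) ≤
      chartForm g p z (a, η) (a, η) ∧ chartForm g p z (a, η) (a, η) ≤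
      C₁ * chartForm (coneMetric h) p z (a, η) (a, η) := h₁ _ _
  rw [hc] at h3 h4
  have e1 : D⁻¹ * ‖η‖ ^ 2 ≤ chartForm h p.2 z.2 η η := by
    refine le_trans ?_ hb1
    gcongr
    exact le_max_right _ _
  have e2 : chartForm h p.2 z.2 η η ≤ D * ‖η‖ ^ 2 := by
    refine hb2.trans ?_
    gcongr
    exact le_max_right _ _
  have e3 : D⁻¹ * a ^ 2 ≤ a ^ 2 := mul_le_of_le_one_left (sq_nonneg _) (inv_le_one_of_one_le₀ hD1)
  have e4 : a ^ 2 ≤ D * a ^ 2 := le_mul_of_one_le_left (sq_nonneg _) hD1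
  have e5 := mul_le_mul_of_nonneg_left e1 (sq_nonneg z.1)
  have e6 := mul_le_mul_of_nonneg_left e2 (sq_nonneg z.1)
  constructor
  · refine le_trans ?_ h3
    rw [mul_inv, mul_assoc]
    gcongr
    linarith
  · refine h4.trans ?_
    rw [mul_assoc]
    gcongr
    linarith

end ConeChart

/-! ### The Sobolev inequality over a small part of the link -/

section ChartIntegral

variable {E H : Type*} [NormedAddCommGroup E] [NormedSpace ℝ E] [TopologicalSpace H]
  {I : ModelWithCorners ℝ E H} [I.Boundaryless]
  {M : Type*} [TopologicalSpace M] [ChartedSpace H M] [IsManifold I ∞ M]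
  {ι : Type*} [Fintype ι] [DecidableEq ι] [MeasurableSpace E] [BorelSpace E]
  [MeasurableSpace M] [BorelSpace M]

/-- The change of variables to a chart is only stated against the weighted measure: the volume
density is not known to be measurable, so it cannot be moved into the integrand. -/
theorem lintegral_chartVolume_eq (b : Module.Basis ι ℝ E) (g : SmoothMetric I M) (x₀ : M)
    {F : M → ℝ≥0∞} (hF : AEMeasurable F (chartVolume b g x₀)) :
    ∫⁻ x, F x ∂(chartVolume b g x₀) = ∫⁻ z, F ((extChartAt I x₀).symm z)
      ∂((b.addHaar.restrict (extChartAt I x₀).target).withDensity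
        (fun y => ENNReal.ofReal (volumeDensity b g x₀ y))) :=
  lintegral_map' hF (((continuousOn_extChartAt_symm x₀).aemeasurable
    (isOpen_extChartAt_target x₀).measurableSet).mono_ac (withDensity_absolutelyContinuous _ _))

/-- An upper bound of the volume density gives an upper bound of integrals over a part of a
chart. -/
theorem setLIntegral_chartVolume_le (b : Module.Basis ι ℝ E) (g : SmoothMetric I M) (x₀ : M)
    {W : Set E} (hW : MeasurableSet W) {ρ : E → ℝ≥0∞} (hρ : Measurable ρ)
    (hd : ∀ z ∈ W, ENNReal.ofReal (volumeDensity b g x₀ z) ≤ ρ z) {U : Set M}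
    (hU : MeasurableSet U)
    (hUW : ∀ z ∈ (extChartAt I x₀).target, (extChartAt I x₀).symm z ∈ U → z ∈ W)
    {F : M → ℝ≥0∞} (hF : Measurable F) :
    ∫⁻ x in U, F x ∂(chartVolume b g x₀) ≤
      ∫⁻ z in W, ρ z * F ((extChartAt I x₀).symm z) ∂b.addHaar := by
  set T := (extChartAt I x₀).target with hT
  have hTm : MeasurableSet T := (isOpen_extChartAt_target x₀).measurableSet
  set ν := b.addHaar.restrict T with hν
  set d : E → ℝ≥0∞ := fun y => ENNReal.ofReal (volumeDensity b g x₀ y) with hdd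
  have hsymm : AEMeasurable (extChartAt I x₀).symm ν :=
    (continuousOn_extChartAt_symm x₀).aemeasurable hTm
  have hae : ∀ᵐ z ∂(ν.withDensity d), z ∈ T :=
    (withDensity_absolutelyContinuous ν d).ae_le (ae_restrict_mem hTm)
  rw [← lintegral_indicator hU, lintegral_chartVolume_eq b g x₀ (hF.indicator hU).aemeasurable]
  calc _ ≤ ∫⁻ z, W.indicator (fun z => F ((extChartAt I x₀).symm z)) z ∂(ν.withDensity d) := by
        refine lintegral_mono_ae ?_
        filter_upwards [hae] with z hz
        by_cases h : (extChartAt I x₀).symm z ∈ U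
        · rw [indicator_of_mem h, indicator_of_mem (hUW z hz h)]
        · rw [indicator_of_notMem h]
          exact zero_le
    _ = ∫⁻ z, F ((extChartAt I x₀).symm z) ∂((ν.restrict W).withDensity d) := by
        rw [lintegral_indicator hW, restrict_withDensity hW]
    _ ≤ ∫⁻ z, F ((extChartAt I x₀).symm z) ∂((ν.restrict W).withDensity ρ) := by
        refine lintegral_mono' (withDensity_mono ?_) le_rfl
        filter_upwards [ae_restrict_mem hW] with z hz
        exact hd z hz
    _ = ∫⁻ z in W, ρ z * F ((extChartAt I x₀).symm z) ∂ν := by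
        rw [lintegral_withDensity_eq_lintegral_mul₀ hρ.aemeasurable]
        · rfl
        · exact (hF.comp_aemeasurable hsymm).mono_measure Measure.restrict_le_self
    _ ≤ _ := by
        refine lintegral_mono' (Measure.restrict_mono le_rfl Measure.restrict_le_self) le_rfl

/-- A lower bound of the volume density gives a lower bound of integrals over a chart. The function
`G` on the manifold need not be measurable, as long as it is bounded below in the chart by a
measurable function `Γ`. -/
theorem setLIntegral_le_lintegral_chartVolume (b : Module.Basis ι ℝ E) (g : SmoothMetric I M)
    (x₀ : M) {W : Set E} (hW : IsOpen W) (hWT : W ⊆ (extChartAt I x₀).target) {ρ : E → ℝ≥0∞}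
    (hρ : Measurable ρ) (hd : ∀ z ∈ W, ρ z ≤ ENNReal.ofReal (volumeDensity b g x₀ z))
    {Γ : E → ℝ≥0∞} (hΓ : Measurable Γ) {G : M → ℝ≥0∞}
    (hG : ∀ z ∈ W, Γ z ≤ G ((extChartAt I x₀).symm z)) :
    ∫⁻ z in W, ρ z * Γ z ∂b.addHaar ≤ ∫⁻ x, G x ∂(chartVolume b g x₀) := by
  set T := (extChartAt I x₀).target with hT
  set ν := b.addHaar.restrict T with hν
  set d : E → ℝ≥0∞ := fun y => ENNReal.ofReal (volumeDensity b g x₀ y) with hdd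
  set U := (extChartAt I x₀).source ∩ extChartAt I x₀ ⁻¹' W with hU
  have hUm : MeasurableSet U := ((continuousOn_extChartAt x₀).isOpen_inter_preimage
    (isOpen_extChartAt_source x₀) hW).measurableSet
  set F : M → ℝ≥0∞ := U.indicator (fun x => Γ (extChartAt I x₀ x)) with hF
  have hFm : AEMeasurable F (chartVolume b g x₀) := by
    rw [hF, aemeasurable_indicator_iff hUm]
    exact hΓ.comp_aemeasurable
      (((continuousOn_extChartAt x₀).mono inter_subset_left).aemeasurable hUm)
  have hFG : F ≤ G := by
    intro x
    by_cases hx : x ∈ U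
    · rw [hF, indicator_of_mem hx]
      have := hG _ hx.2
      rwa [(extChartAt I x₀).left_inv hx.1] at this
    · rw [hF, indicator_of_notMem hx]
      exact zero_le
  calc _ = ∫⁻ z in W, ρ z * Γ z ∂ν := by
        rw [hν, Measure.restrict_restrict hW.measurableSet, inter_eq_left.2 hWT]
    _ = ∫⁻ z, Γ z ∂((ν.restrict W).withDensity ρ) := by
        rw [lintegral_withDensity_eq_lintegral_mul₀ hρ.aemeasurable hΓ.aemeasurable]
        rfl
    _ ≤ ∫⁻ z, Γ z ∂((ν.restrict W).withDensity d) := by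
        refine lintegral_mono' (withDensity_mono ?_) le_rfl
        filter_upwards [ae_restrict_mem hW.measurableSet] with z hz
        exact hd z hz
    _ = ∫⁻ z, W.indicator Γ z ∂(ν.withDensity d) := by
        rw [lintegral_indicator hW.measurableSet, restrict_withDensity hW.measurableSet]
    _ ≤ ∫⁻ z, F ((extChartAt I x₀).symm z) ∂(ν.withDensity d) := by
        refine lintegral_mono fun z => ?_
        by_cases hz : z ∈ W
        · have h1 : (extChartAt I x₀).symm z ∈ U :=
            ⟨(extChartAt I x₀).map_target (hWT hz), by
              rw [mem_preimage, (extChartAt I x₀).right_inv (hWT hz)]; exact hz⟩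
          simp only [hF]
          rw [indicator_of_mem hz, indicator_of_mem h1, (extChartAt I x₀).right_inv (hWT hz)]
        · rw [indicator_of_notMem hz]
          exact zero_le
    _ = ∫⁻ x, F x ∂(chartVolume b g x₀) := (lintegral_chartVolume_eq b g x₀ hFm).symm
    _ ≤ _ := lintegral_mono hFG

end ChartIntegral

section LocalSobolev

variable {k : ℕ} {L : Type*} [TopologicalSpace L] [ChartedSpace (EuclideanSpace ℝ (Fin k)) L]

theorem exists_radius_mem_Icc_of_hasCompactSupport {u : Cone L → ℝ} (hu : HasCompactSupport u) :
    ∃ a b : ℝ, 0 < a ∧ ∀ x, u x ≠ 0 → Cone.radius x ∈ Icc a b := by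
  have hr : Continuous (Cone.radius : Cone L → ℝ) := continuous_subtype_val.comp continuous_fst
  rcases (tsupport u).eq_empty_or_nonempty with h | h
  · refine ⟨1, 1, one_pos, fun x hx => ?_⟩
    have := subset_tsupport u hx
    rw [h] at this
    exact this.elim
  · obtain ⟨x, -, hx⟩ := hu.exists_isMinOn h hr.continuousOn
    obtain ⟨y, -, hy⟩ := hu.exists_isMaxOn h hr.continuousOn
    exact ⟨Cone.radius x, Cone.radius y, x.1.2, fun z hz =>
      ⟨hx (subset_tsupport u hz), hy (subset_tsupport u hz)⟩⟩

variable [IsManifold (𝓡 k) ∞ L]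

/-- In a chart where `g ≤ C (dr² + r² |dy|²)`, the gradient bounds the energy density: apply the
Cauchy-Schwarz inequality for `g` to the coordinate directions. -/
theorem coneEnergy_comp_symm_le (g : SmoothMetric (coneModel k) (Cone L)) (p : Cone L)
    {u : Cone L → ℝ} (hu : ContMDiff (coneModel k) 𝓘(ℝ, ℝ) ∞ u) {C : ℝ} (hC : 0 < C)
    {z : ℝ × EuclideanSpace ℝ (Fin k)} (hz : z ∈ (extChartAt (coneModel k) p).target)
    (hb : ∀ (a : ℝ) (η : EuclideanSpace ℝ (Fin k)),
      chartForm g p z (a, η) (a, η) ≤ C * (a ^ 2 + z.1 ^ 2 * ‖η‖ ^ 2)) :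
    coneEnergy (u ∘ (extChartAt (coneModel k) p).symm) z ≤
      2 * C * gradientNormSq g u ((extChartAt (coneModel k) p).symm z) := by
  set φ := extChartAt (coneModel k) p with hφ
  set Γ := gradientNormSq g u (φ.symm z) with hΓ
  have hΓ0 : 0 ≤ Γ := g.inner_self_nonneg _ _
  have hz' := hz
  rw [hφ, extChartAt_cone_target] at hz'
  have hr : 0 < z.1 := hz'.1
  have key : ∀ (a : ℝ) (η : EuclideanSpace ℝ (Fin k)),
      (fderiv ℝ (u ∘ φ.symm) z (a, η)) ^ 2 ≤ Γ * (C * (a ^ 2 + z.1 ^ 2 * ‖η‖ ^ 2)) := by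
    intro a η
    have h1 := mfderiv_comp_apply z ((hu (φ.symm z)).mdifferentiableAt (by simp))
      (mdifferentiableAt_extChartAt_symm hz) (a, η)
    rw [mfderiv_eq_fderiv] at h1
    exact (sq_mfderiv_le_gradientNormSq_mul g u (φ.symm z) _ h1.symm).trans
      (mul_le_mul_of_nonneg_left (hb a η) hΓ0)
  have h1 := key 1 0
  have h2 : ‖(fderiv ℝ (u ∘ φ.symm) z).comp
      (ContinuousLinearMap.inr ℝ ℝ (EuclideanSpace ℝ (Fin k)))‖ ≤ √(C * Γ) * z.1 := by
    refine ContinuousLinearMap.opNorm_le_bound _ (by positivity) fun η => ?_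
    have h3 := key 0 η
    rw [ContinuousLinearMap.comp_apply, ContinuousLinearMap.inr_apply, Real.norm_eq_abs]
    refine abs_le_of_sq_le_sq ?_ (by positivity)
    rw [mul_pow, mul_pow, Real.sq_sqrt (by positivity)]
    linarith
  have h4 : z.1⁻¹ * ‖(fderiv ℝ (u ∘ φ.symm) z).comp
      (ContinuousLinearMap.inr ℝ ℝ (EuclideanSpace ℝ (Fin k)))‖ ≤ √(C * Γ) := by
    rw [inv_mul_le_iff₀ hr, mul_comm z.1]
    exact h2
  have h5 := pow_le_pow_left₀ (by positivity) h4 2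
  rw [Real.sq_sqrt (by positivity)] at h5
  rw [norm_zero] at h1
  unfold coneEnergy
  linarith

variable [MeasurableSpace L] [BorelSpace L] [SecondCountableTopology L]

/-- The Sobolev inequality for the part of the cone over a small open subset of the link. -/
theorem exists_local_sobolev {n : ℕ} (hn : 3 ≤ n) (hk : k + 1 = n) (h : SmoothMetric (𝓡 k) L)
    {g : SmoothMetric (coneModel k) (Cone L)} (hg : UniformlyEquivalent g (coneMetric h))
    (p : Cone L) :
    ∃ V ∈ 𝓝 p.2, ∃ C : ℝ≥0, ∀ u : Cone L → ℝ, ContMDiff (coneModel k) 𝓘(ℝ, ℝ) ∞ u →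
      HasCompactSupport u →
      (∫⁻ x in Prod.snd ⁻¹' V, ‖u x‖ₑ ^ (2 * (n : ℝ) / ((n : ℝ) - 2)) ∂(coneVolume g))
          ^ (((n : ℝ) - 2) / (n : ℝ)) ≤
        C * ∫⁻ x, ENNReal.ofReal (gradientNormSq g u x) ∂(coneVolume g) := by
  have hn' : (3 : ℝ) ≤ n := by exact_mod_cast hn
  have he : 0 ≤ ((n : ℝ) - 2) / n := div_nonneg (by linarith) (by linarith)
  set φ := extChartAt (coneModel k) p with hφ
  set ψ := extChartAt (𝓡 k) p.2 with hψ
  set y₀ := ψ p.2 with hy₀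
  obtain ⟨C, hC, ε, hε, hball, hbd⟩ := exists_chartForm_cone_bounds h hg p
  obtain ⟨C₁, hC₁⟩ := lintegral_sobolev_cone_ball
    (volume : Measure (EuclideanSpace ℝ (Fin k))) hn (by simpa using hk) y₀ hε
  set W := Ioi (0 : ℝ) ×ˢ Metric.ball y₀ (3 * ε) with hW
  have hWo : IsOpen W := isOpen_Ioi.prod Metric.isOpen_ball
  have hWT : W ⊆ φ.target := by
    rw [hφ, extChartAt_cone_target]
    exact prod_mono_right hball
  set A := √(C ^ (k + 1)) with hA
  set c := √(C⁻¹ ^ (k + 1)) with hc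
  have hc0 : 0 < c := by positivity
  have hdens : ∀ z ∈ W, c * z.1 ^ k ≤ volumeDensity (coneBasis k) g p z ∧
      volumeDensity (coneBasis k) g p z ≤ A * z.1 ^ k := by
    intro z hz
    rw [volumeDensity_eq]
    exact sqrt_det_toMatrix_coneBasis_bounds (chartForm_isSymm g p z) (by positivity) hz.1
      (hbd z hz)
  have hWε : Ioi (0 : ℝ) ×ˢ Metric.ball y₀ ε ⊆ W :=
    prod_mono_right (Metric.ball_subset_ball (by linarith))
  set V := ψ.source ∩ ψ ⁻¹' Metric.ball y₀ ε with hV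
  have hVo : IsOpen V := (continuousOn_extChartAt p.2).isOpen_inter_preimage
    (isOpen_extChartAt_source p.2) Metric.isOpen_ball
  have hUm : MeasurableSet (Prod.snd ⁻¹' V : Set (Cone L)) :=
    (hVo.preimage continuous_snd).measurableSet
  have hUS : (Prod.snd ⁻¹' V : Set (Cone L)) ⊆ φ.source := by
    rw [hφ, extChartAt_cone_source]
    exact fun x hx => ⟨trivial, hx.1⟩
  refine ⟨V, hVo.mem_nhds ⟨mem_extChartAt_source p.2, Metric.mem_ball_self hε⟩,
    A.toNNReal ^ (((n : ℝ) - 2) / n) * (C₁ * (c⁻¹ * (2 * C)).toNNReal), fun u hu hus => ?_⟩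
  set v := u ∘ φ.symm with hv
  obtain ⟨a, b, ha, hab⟩ := exists_radius_mem_Icc_of_hasCompactSupport hus
  have hv1 : ContDiffOn ℝ 1 v W := by
    have h1 : ContMDiffOn 𝓘(ℝ, ℝ × EuclideanSpace ℝ (Fin k)) 𝓘(ℝ, ℝ) ∞ v φ.target :=
      hu.comp_contMDiffOn (contMDiffOn_extChartAt_symm p)
    exact ((contMDiffOn_iff_contDiffOn.1 h1).mono hWT).of_le (by exact_mod_cast le_top)
  have hv2 : ∀ z ∈ W, v z ≠ 0 → z.1 ∈ Icc a b := by
    intro z hz hvz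
    have := hab _ hvz
    rwa [radius_extChartAt_cone_symm p hz.1] at this
  have hsob := hC₁ v hv1 a b ha hv2
  rw [← coneBasis_addHaar, show n - 1 = k by omega] at hsob
  have hum : Measurable fun x => ‖u x‖ₑ ^ (2 * (n : ℝ) / ((n : ℝ) - 2)) :=
    hu.continuous.measurable.enorm.pow_const _
  -- the volume density is at most `A r ^ k`
  have hupper : ∫⁻ x in Prod.snd ⁻¹' V, ‖u x‖ₑ ^ (2 * (n : ℝ) / ((n : ℝ) - 2)) ∂(coneVolume g) ≤
      A.toNNReal * ∫⁻ z in Ioi (0 : ℝ) ×ˢ Metric.ball y₀ ε, ENNReal.ofReal (z.1 ^ k) *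
        ‖v z‖ₑ ^ (2 * (n : ℝ) / ((n : ℝ) - 2)) ∂(coneBasis k).addHaar := by
    have h1 : (coneVolume g).restrict (Prod.snd ⁻¹' V) ≤
        (chartVolume (coneBasis k) g p).restrict (Prod.snd ⁻¹' V) := by
      have h2 := Measure.restrict_mono (le_refl (Prod.snd ⁻¹' V : Set (Cone L)))
        (riemannianVolume_restrict_source_le (coneBasis k) g p)
      rwa [Measure.restrict_restrict hUm, inter_eq_left.2 hUS] at h2
    calc _ ≤ _ := lintegral_mono' h1 le_rfl
      _ ≤ ∫⁻ z in Ioi (0 : ℝ) ×ˢ Metric.ball y₀ ε, ENNReal.ofReal (A * z.1 ^ k) *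
          ‖u (φ.symm z)‖ₑ ^ (2 * (n : ℝ) / ((n : ℝ) - 2)) ∂(coneBasis k).addHaar := by
        refine setLIntegral_chartVolume_le (coneBasis k) g p
          (measurableSet_Ioi.prod measurableSet_ball) (by fun_prop)
          (fun z hz => ENNReal.ofReal_le_ofReal (hdens z (hWε hz)).2) hUm (fun z hz hzU => ?_) hum
        have hz' := hz
        rw [extChartAt_cone_target] at hz'
        refine ⟨hz'.1, ?_⟩
        have h3 := hzU.2
        rw [mem_preimage, extChartAt_cone_symm_snd, hψ, (extChartAt (𝓡 k) p.2).right_inv hz'.2]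
          at h3
        exact h3
      _ = _ := by
        rw [← lintegral_const_mul' _ _ ENNReal.coe_ne_top]
        refine lintegral_congr fun z => ?_
        rw [ENNReal.ofReal_mul (Real.sqrt_nonneg _), mul_assoc]
        rfl
  -- the volume density is at least `c r ^ k`
  have hlower : ∫⁻ z in W, ENNReal.ofReal (z.1 ^ k) * ENNReal.ofReal (coneEnergy v z)
        ∂(coneBasis k).addHaar ≤
      (c⁻¹ * (2 * C)).toNNReal *
        ∫⁻ x, ENNReal.ofReal (gradientNormSq g u x) ∂(coneVolume g) := by
    have hm := measurable_coneEnergy v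
    have hCc : 0 < c⁻¹ * (2 * C) := by positivity
    calc _ = ∫⁻ z in W, ENNReal.ofReal (c * z.1 ^ k) * ENNReal.ofReal (c⁻¹ * coneEnergy v z)
        ∂(coneBasis k).addHaar := by
          refine lintegral_congr fun z => ?_
          have h1 : ENNReal.ofReal c * ENNReal.ofReal c⁻¹ = 1 := by
            rw [← ENNReal.ofReal_mul hc0.le, mul_inv_cancel₀ hc0.ne', ENNReal.ofReal_one]
          rw [ENNReal.ofReal_mul hc0.le, ENNReal.ofReal_mul (inv_nonneg.2 hc0.le),
            mul_mul_mul_comm, h1, one_mul]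
      _ ≤ ∫⁻ x, (c⁻¹ * (2 * C)).toNNReal * ENNReal.ofReal (gradientNormSq g u x)
          ∂(chartVolume (coneBasis k) g p) := by
          refine setLIntegral_le_lintegral_chartVolume (coneBasis k) g p hWo hWT (by fun_prop)
            (fun z hz => ENNReal.ofReal_le_ofReal (hdens z hz).1) (by fun_prop) fun z hz => ?_
          have h1 := coneEnergy_comp_symm_le g p hu hC (hWT hz) fun a η => (hbd z hz a η).2
          change _ ≤ ENNReal.ofReal _ * _
          rw [← ENNReal.ofReal_mul hCc.le, mul_assoc]
          exact ENNReal.ofReal_le_ofReal (mul_le_mul_of_nonneg_left h1 (inv_nonneg.2 hc0.le))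
      _ ≤ ∫⁻ x, (c⁻¹ * (2 * C)).toNNReal * ENNReal.ofReal (gradientNormSq g u x)
          ∂(coneVolume g) :=
          lintegral_mono' (chartVolume_le_riemannianVolume (coneBasis k) g p) le_rfl
      _ = _ := lintegral_const_mul' _ _ ENNReal.coe_ne_top
  calc _ ≤ _ := ENNReal.rpow_le_rpow hupper he
    _ = (A.toNNReal ^ (((n : ℝ) - 2) / n) : ℝ≥0) * _ := by
        rw [ENNReal.mul_rpow_of_nonneg _ _ he, ENNReal.coe_rpow_of_nonneg _ he]
    _ ≤ (A.toNNReal ^ (((n : ℝ) - 2) / n) : ℝ≥0) * (C₁ * ((c⁻¹ * (2 * C)).toNNReal *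
          ∫⁻ x, ENNReal.ofReal (gradientNormSq g u x) ∂(coneVolume g))) := by
        gcongr
        exact hsob.trans (mul_le_mul' le_rfl hlower)
    _ = _ := by
        push_cast
        ring

end LocalSobolev

/-! ### The Sobolev and Nash inequalities on the cone -/

section GlobalSobolev

variable {E H : Type*} [NormedAddCommGroup E] [NormedSpace ℝ E] [TopologicalSpace H]
  {I : ModelWithCorners ℝ E H}
  {M : Type*} [TopologicalSpace M] [ChartedSpace H M] [IsManifold I ∞ M]

theorem gradientNormSq_eq_zero_of_notMem_tsupport [FiniteDimensional ℝ E] (g : SmoothMetric I M)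
    {u : M → ℝ} {x : M} (hx : x ∉ tsupport u) : gradientNormSq g u x = 0 := by
  have hu : u =ᶠ[𝓝 x] fun _ => 0 := notMem_tsupport_iff_eventuallyEq.1 hx
  have h : (mfderiv I 𝓘(ℝ, ℝ) u x : TangentSpace I x →L[ℝ] ℝ) = 0 := by
    rw [hu.mfderiv_eq]
    exact mfderiv_const
  have h2 : riemannianGradient g u x = 0 := by
    unfold riemannianGradient
    rw [h]
    exact map_zero _
  unfold gradientNormSq
  rw [h2, map_zero]

/-- The set `B` need not be measurable. -/
theorem lintegral_gradientNormSq_le_of_tsupport_subset [FiniteDimensional ℝ E] [MeasurableSpace M]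
    [OpensMeasurableSpace M] (μ : Measure M) (g : SmoothMetric I M) {u : M → ℝ} {B : Set M}
    (hB : tsupport u ⊆ B) :
    ∫⁻ x, ENNReal.ofReal (gradientNormSq g u x) ∂μ ≤
      ∫⁻ x in B, ENNReal.ofReal (gradientNormSq g u x) ∂μ := by
  refine le_trans ?_ (lintegral_mono_set hB)
  rw [← Measure.restrict_univ (μ := μ), Measure.restrict_restrict_of_subset (subset_univ _)]
  refine setLIntegral_le_of_eq_zero .univ (isClosed_tsupport u).measurableSet fun x _ hx => ?_
  rw [gradientNormSq_eq_zero_of_notMem_tsupport g hx, ENNReal.ofReal_zero]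

theorem ENNReal.rpow_sum_le_sum_rpow_of_le_one {ι : Type*} (t : Finset ι) (f : ι → ℝ≥0∞) {e : ℝ}
    (h0 : 0 < e) (h1 : e ≤ 1) : (∑ i ∈ t, f i) ^ e ≤ ∑ i ∈ t, f i ^ e := by
  classical
  induction t using Finset.induction_on with
  | empty => simp [ENNReal.zero_rpow_of_pos h0]
  | insert i t hi ih =>
    rw [Finset.sum_insert hi, Finset.sum_insert hi]
    exact (ENNReal.rpow_add_le_add_rpow _ _ h0.le h1).trans (add_le_add le_rfl ih)

/-- The Sobolev inequality on the whole cone. -/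
theorem exists_cone_sobolev {k n : ℕ} (hn : 3 ≤ n) (hk : k + 1 = n) {L : Type*}
    [TopologicalSpace L] [ChartedSpace (EuclideanSpace ℝ (Fin k)) L] [IsManifold (𝓡 k) ∞ L]
    [CompactSpace L] [MeasurableSpace L] [BorelSpace L] [SecondCountableTopology L]
    (h : SmoothMetric (𝓡 k) L) {g : SmoothMetric (coneModel k) (Cone L)}
    (hg : UniformlyEquivalent g (coneMetric h)) :
    ∃ C : ℝ≥0, ∀ u : Cone L → ℝ, ContMDiff (coneModel k) 𝓘(ℝ, ℝ) ∞ u → HasCompactSupport u →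
      (∫⁻ x, ‖u x‖ₑ ^ (2 * (n : ℝ) / ((n : ℝ) - 2)) ∂(coneVolume g))
          ^ (((n : ℝ) - 2) / (n : ℝ)) ≤
        C * ∫⁻ x, ENNReal.ofReal (gradientNormSq g u x) ∂(coneVolume g) := by
  have hn' : (3 : ℝ) ≤ n := by exact_mod_cast hn
  have he : 0 < ((n : ℝ) - 2) / n := div_pos (by linarith) (by linarith)
  have he1 : ((n : ℝ) - 2) / n ≤ 1 := (div_le_one (by linarith)).2 (by linarith)
  choose V hV C hC using fun x : L => exists_local_sobolev hn hk h hg (⟨1, mem_Ioi.2 one_pos⟩, x)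
  obtain ⟨t, ht⟩ := CompactSpace.elim_nhds_subcover V hV
  refine ⟨∑ x ∈ t, C x, fun u hu hus => ?_⟩
  have hcover : (⋃ x : t, Prod.snd ⁻¹' V x : Set (Cone L)) = univ := by
    refine eq_univ_of_forall fun p => ?_
    have hp : p.2 ∈ ⋃ x ∈ t, V x := by rw [ht]; trivial
    obtain ⟨x, hx, hpx⟩ := mem_iUnion₂.1 hp
    exact mem_iUnion.2 ⟨⟨x, hx⟩, hpx⟩
  calc _ ≤ (∑ x ∈ t, ∫⁻ y in Prod.snd ⁻¹' V x, ‖u y‖ₑ ^ (2 * (n : ℝ) / ((n : ℝ) - 2))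
        ∂(coneVolume g)) ^ (((n : ℝ) - 2) / (n : ℝ)) := by
        refine ENNReal.rpow_le_rpow ?_ he.le
        rw [← setLIntegral_univ, ← hcover]
        refine (lintegral_iUnion_le _ _).trans ?_
        rw [tsum_fintype, Finset.sum_coe_sort t (fun x => ∫⁻ y in Prod.snd ⁻¹' V x,
          ‖u y‖ₑ ^ (2 * (n : ℝ) / ((n : ℝ) - 2)) ∂(coneVolume g))]
    _ ≤ ∑ x ∈ t, (∫⁻ y in Prod.snd ⁻¹' V x, ‖u y‖ₑ ^ (2 * (n : ℝ) / ((n : ℝ) - 2))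
        ∂(coneVolume g)) ^ (((n : ℝ) - 2) / (n : ℝ)) :=
        ENNReal.rpow_sum_le_sum_rpow_of_le_one t _ he he1
    _ ≤ ∑ x ∈ t, C x * ∫⁻ y, ENNReal.ofReal (gradientNormSq g u y) ∂(coneVolume g) :=
        Finset.sum_le_sum fun x _ => hC x u hu hus
    _ = _ := by
        rw [← Finset.sum_mul]
        push_cast
        rfl

/-- Hölder's inequality interpolates `L²` between `L¹` and `L^{2n/(n-2)}`. -/
theorem lintegral_sq_rpow_le_of_holder {α : Type*} [MeasurableSpace α] (μ : Measure α) {n : ℕ}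
    (hn : 3 ≤ n) {f : α → ℝ≥0∞} (hf : AEMeasurable f μ) :
    (∫⁻ x, f x ^ 2 ∂μ) ^ (1 + 2 / (n : ℝ)) ≤
      (∫⁻ x, f x ^ (2 * (n : ℝ) / ((n : ℝ) - 2)) ∂μ) ^ (((n : ℝ) - 2) / (n : ℝ)) *
        (∫⁻ x, f x ∂μ) ^ (4 / (n : ℝ)) := by
  have hn' : (3 : ℝ) ≤ n := by exact_mod_cast hn
  have h2 : (0 : ℝ) < n - 2 := by linarith
  have h0 : (0 : ℝ) < n := by linarith
  have ha : 0 ≤ ((n : ℝ) - 2) / (n + 2) := by positivity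
  have hb : 0 ≤ 4 / ((n : ℝ) + 2) := by positivity
  have h := ENNReal.lintegral_mul_norm_pow_le
    (f := fun x => f x ^ (2 * (n : ℝ) / ((n : ℝ) - 2))) (hf.pow_const _) hf ha hb
    (by field_simp; ring)
  have e1 : ∀ x, (f x ^ (2 * (n : ℝ) / ((n : ℝ) - 2))) ^ (((n : ℝ) - 2) / (n + 2)) *
      f x ^ (4 / ((n : ℝ) + 2)) = f x ^ 2 := by
    intro x
    rw [← ENNReal.rpow_mul, ← ENNReal.rpow_add_of_nonneg _ _ (by positivity) hb,
      ← ENNReal.rpow_natCast]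
    congr 1
    push_cast
    field_simp
    ring
  simp only [e1] at h
  have e2 : 0 ≤ 1 + 2 / (n : ℝ) := by positivity
  refine (ENNReal.rpow_le_rpow h e2).trans (le_of_eq ?_)
  rw [ENNReal.mul_rpow_of_nonneg _ _ e2, ← ENNReal.rpow_mul, ← ENNReal.rpow_mul]
  congr 2
  · field_simp
  · field_simp

end GlobalSobolev

theorem propositionA1 (n : ℕ) (hn : 3 ≤ n) {L : Type*} [TopologicalSpace L]
    [ChartedSpace (EuclideanSpace ℝ (Fin (n - 1))) L] [IsManifold (𝓡 (n - 1)) ∞ L]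
    [T2Space L] [CompactSpace L] [ConnectedSpace L] [MeasurableSpace L] [BorelSpace L]
    (h : SmoothMetric (𝓡 (n - 1)) L)
    (g : SmoothMetric (coneModel (n - 1)) (Cone L))
    (hg : UniformlyEquivalent g (coneMetric h)) :
    (∃ C : ℝ≥0, ∀ (p : ConeClosure L) (r : ℝ≥0∞), 0 < r →
      ∀ u : Cone L → ℝ, IsTestFunction (coneModel (n - 1)) (coneBall h p r) u →
        (∫⁻ x in coneBall h p r, ‖u x‖ₑ ^ (2 * (n : ℝ) / ((n : ℝ) - 2)) ∂(coneVolume g))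
            ^ (((n : ℝ) - 2) / (n : ℝ))
          ≤ C * ∫⁻ x in coneBall h p r, ENNReal.ofReal (gradientNormSq g u x) ∂(coneVolume g)) ∧
    (∃ C : ℝ≥0, ∀ (p : ConeClosure L) (r : ℝ≥0∞), 0 < r →
      ∀ u : Cone L → ℝ, IsTestFunction (coneModel (n - 1)) (coneBall h p r) u →
        (∫⁻ x in coneBall h p r, ‖u x‖ₑ ^ 2 ∂(coneVolume g)) ^ (1 + 2 / (n : ℝ))
          ≤ C * (∫⁻ x in coneBall h p r, ENNReal.ofReal (gradientNormSq g u x) ∂(coneVolume g))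
            * (∫⁻ x in coneBall h p r, ‖u x‖ₑ ∂(coneVolume g)) ^ (4 / (n : ℝ))) := by

  have : SecondCountableTopology L :=
    ChartedSpace.secondCountable_of_sigmaCompact (EuclideanSpace ℝ (Fin (n - 1))) L
  obtain ⟨C, hC⟩ := exists_cone_sobolev (k := n - 1) hn (by omega) h hg
  have hsob : ∀ (p : ConeClosure L) (r : ℝ≥0∞) (u : Cone L → ℝ),
      IsTestFunction (coneModel (n - 1)) (coneBall h p r) u →
      (∫⁻ x in coneBall h p r, ‖u x‖ₑ ^ (2 * (n : ℝ) / ((n : ℝ) - 2)) ∂(coneVolume g))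
          ^ (((n : ℝ) - 2) / (n : ℝ)) ≤
        C * ∫⁻ x in coneBall h p r, ENNReal.ofReal (gradientNormSq g u x) ∂(coneVolume g) := by
    rintro p r u ⟨hu, hus, huB⟩
    have hn' : (3 : ℝ) ≤ n := by exact_mod_cast hn
    calc _ ≤ _ := ENNReal.rpow_le_rpow (setLIntegral_le_lintegral _ _)
          (div_nonneg (by linarith) (by linarith))
      _ ≤ _ := hC u hu hus
      _ ≤ _ := mul_le_mul' le_rfl
          (lintegral_gradientNormSq_le_of_tsupport_subset (coneVolume g) g huB)
  refine ⟨⟨C, fun p r _ u hu => hsob p r u hu⟩, C, fun p r _ u hu => ?_⟩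
  exact (lintegral_sq_rpow_le_of_holder _ hn hu.1.continuous.measurable.enorm.aemeasurable).trans
    (mul_le_mul' (hsob p r u hu) le_rfl)
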